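/- **Setting.** Let $0\le\kappa<n$ be integers, let $f:\mathbb{R}^n\to\mathbb{R}$, $g:\mathbb{R}^n\to\mathbb{R}^m$, $h:\mathbb{R}^n\to\mathbb{R}^p$ be continuously differentiable, and let $\|x\|_0$ be the number of nonzero components of $x$. Consider the cardinality constrained problem $$\text{(P)}\quad \min_x f(x)\ \text{ s.t. } g(x)\le 0,\ h(x)=0,\ \|x\|_0\le\kappa ,$$ its continuous reformulation, with feasible set $Z$, $$\text{(R)}\quad \min_{(x,y)} f(x)\ \text{ s.t. } g(x)\le 0,\ h(x)=0,\ 0\le y\le e,\ e^Ty\ge n-\kappa,\ x\circ y=0,$$ where $e=(1,\dots,1)^T$ and $\circ$ is the componentwise product, and, for $t>0$, the regularization NLP$(t)$, which is (R) with $x\circ y=0$ replaced by $-te\le x\circ y\le te$. KKT points of NLP$(t)$ are those of NLP$(t)$ as a standard nonlinear program. $B_r(x)$ is the open ball. For $(x,y)\in Z$ let $I_g=\{i: g_i(x)=0\}$, $I_0=\{i:x_i=0\}$, $I_{\pm0}=\{i:x_i\ne0,y_i=0\}$, $I_{00}=\{i:x_i=0,y_i=0\}$, $I_{0+}=\{i:x_i=0,\,0<y_i<1\}$,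 $I_{01}=\{i:x_i=0,y_i=1\}$. * *CC-MFCQ* holds at $x$ (or $(x,y)$) if there is no $(\lambda,\mu,\gamma)\neq0$ with $\lambda_i\ge0$ $(i\in I_g)$ and $\sum_{i\in I_g}\lambda_i\nabla g_i(x)+\sum_{i=1}^p\mu_i\nabla h_i(x)+\sum_{i\in I_0}\gamma_ie_i=0$. * $(\lambda,\mu,\gamma)\in\mathbb{R}^m\times\mathbb{R}^p\times\mathbb{R}^n$ is an *M-stationary multiplier* of $(x,y)\in Z$ if $\nabla f(x)+\sum_i\lambda_i\nabla g_i(x)+\sum_i\mu_i\nabla h_i(x)+\sum_i\gamma_ie_i=0$, $\lambda_i\ge0$ and $\lambda_ig_i(x)=0$ for all $i$, and $\gamma_i=0$ for $i\in I_{\pm0}$ (this does not depend on $y$, so one also speaks of M-stationary multipliers of $x$). It is an *S-stationary multiplier* if moreover $\gamma_i=0$ for $i\in I_{00}$. The point $(x,y)\in Z$ is *S-stationary* if it has an S-stationary multiplier. * $(x^*,y^*)\in Z$ is a *strict local minimum of (R) with respect to $x$* if for some $\rho>0$ one has $f(x^*)<f(x)$ for all $(x,y)\in Z\cap B_\rho(x^*,y^*)$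 with $x\ne x^*$. * For $(x,y)\in Z$, $\mathcal{L}_Z(x,y)$ is the set of $(d_x,d_y)\in\mathbb{R}^n\times\mathbb{R}^n$ with $\nabla g_i(x)^Td_x\le0$ $(i\in I_g)$; $\nabla h_i(x)^Td_x=0$ for all $i$; $e^Td_y\ge0$ if $e^Ty=n-\kappa$; $(d_y)_i=0$ $(i\in I_{\pm0})$; $(d_y)_i\ge0$ $(i\in I_{00})$; $(d_y)_i\le0$ $(i\in I_{01})$; $(d_x)_i=0$ $(i\in I_{01}\cup I_{0+})$; $(d_x)_i(d_y)_i=0$ $(i\in I_{00})$. Put $\mathcal{C}_Z(x,y)=\{(d_x,d_y)\in\mathcal{L}_Z(x,y):\nabla f(x)^Td_x\le0\}$ and $\mathcal{C}_{\mathcal X}(x)=\{d_x:\nabla f(x)^Td_x\le 0,\ \exists\,y,d_y:\ (x,y)\in Z,\ (d_x,d_y)\in\mathcal{L}_Z(x,y)\}$. Write $(t_k)\downarrow0$ for a sequence of positive reals converging to $0$. **Theorem.** (a) Let $x^*$ be a strict local minimizer of (P), or let $(x^*,y^*)$ be a strict local minimum of (R) with respect to $x$ with $\|x^*\|_0=\kappa$.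 Suppose CC-MFCQ holds at $x^*$. Then there exist $T>0$ and $r>0$ such that for all $t\in(0,T]$, NLP$(t)$ has a local minimum $(x^t,y^t)$ that is also a KKT point of NLP$(t)$, with $x^t\in B_r(x^*)$. (b) Let $(x^*,y^*)\in Z$ satisfy CC-MFCQ. Then for all sufficiently small $r>0$: if $(t_k)\downarrow0$ and $(x^k,y^k)$ are KKT points of NLP$(t_k)$ with $x^k\in B_r(x^*)$ for all $k$, then $(x^k,y^k)_k$ has accumulation points, and every accumulation point is an S-stationary point of (R). (c) Let $f,g,h$ be twice continuously differentiable. Let $(x^*,y^*)$ be a strict local minimum of (R) with respect to $x$ with $\|x^*\|_0=\kappa$ such that CC-MFCQ holds and $$d_x^T\Big(\nabla^2f(x^*)+\sum_{i=1}^m\lambda_i\nabla^2g_i(x^*)+\sum_{i=1}^p\mu_i\nabla^2h_i(x^*)\Big)d_x>0\qquad(*)$$ for all $(d_x,d_y)\in\mathcal{C}_Z(x^*,y^*)$ with $d_x\neq0$ and all S-stationary multipliers $(\lambda,\mu,\gamma)$ of $(x^*,y^*)$. Then there is $r>0$ such that for every $(t_k)\downarrow0$: for all sufficiently large $k$, NLP$(t_k)$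 has a KKT point $(x^k,y^k)$ with $x^k\in B_r(x^*)$, and every sequence of such KKT points satisfies $(x^k,y^k)\to(x^*,y^*)$. (d) Let $f,g,h$ be twice continuously differentiable. Let $x^*$ be a strict local minimizer of (P) such that CC-MFCQ holds and $(*)$ holds for all $d_x\in\mathcal{C}_{\mathcal X}(x^*)$ with $d_x\ne0$ and all M-stationary multipliers $(\lambda,\mu,\gamma)$ of $x^*$. Then there is $r>0$ such that for every $(t_k)\downarrow0$: for all sufficiently large $k$, NLP$(t_k)$ has a KKT point $(x^k,y^k)$ with $x^k\in B_r(x^*)$, and every sequence of such KKT points satisfies $x^k\to x^*$. -/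

import Mathlib

open Filter Topology

noncomputable section

/-- Euclidean space of dimension `n`. -/
abbrev Euc (n : ℕ) : Type := EuclideanSpace ℝ (Fin n)

/-- Data of the cardinality constrained problem
`min f x` subject to `g x ≤ 0`, `h x = 0`, `‖x‖₀ ≤ κ`. -/
structure CCProblem (n m p : ℕ) where
  f : Euc n → ℝ
  g : Fin m → Euc n → ℝ
  h : Fin p → Euc n → ℝ
  κ : ℕ

/-- `‖x‖₀`, the number of nonzero components of `x`. -/
def zeroNorm {n : ℕ} (x : Euc n) : ℕ :=
  (Finset.univ.filter fun i => x i ≠ 0).card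

/-- The families `a` and `b` are positively linearly dependent. -/
def PosLinDep {ι ι' E : Type*} [Fintype ι] [Fintype ι'] [AddCommGroup E] [Module ℝ E]
    (a : ι → E) (b : ι' → E) : Prop :=
  ∃ (lam : ι → ℝ) (mu : ι' → ℝ), (∀ i, 0 ≤ lam i) ∧ (lam, mu) ≠ 0 ∧
    ∑ i, lam i • a i + ∑ j, mu j • b j = 0

/-- `dᵀ ∇²φ(x) d`, the quadratic form of the Hessian of `φ` at `x`. -/
def hessForm {n : ℕ} (φ : Euc n → ℝ) (x d : Euc n) : ℝ :=
  fderiv ℝ (fderiv ℝ φ) x d d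

namespace CCProblem

variable {n m p : ℕ} (P : CCProblem n m p)

/-- Feasible set of the cardinality constrained problem. -/
def ccFeasible : Set (Euc n) :=
  {x | (∀ i, P.g i x ≤ 0) ∧ (∀ i, P.h i x = 0) ∧ zeroNorm x ≤ P.κ}

/-- The feasible set `Z` of the continuous reformulation. -/
def Z : Set (Euc n × Euc n) :=
  {z | (∀ i, P.g i z.1 ≤ 0) ∧ (∀ i, P.h i z.1 = 0) ∧
    (∀ i, 0 ≤ z.2 i ∧ z.2 i ≤ 1) ∧ (n : ℝ) - (P.κ : ℝ) ≤ ∑ i, z.2 i ∧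
    ∀ i, z.1 i * z.2 i = 0}

/-- The feasible set `Z(t)` of the Scholtes regularization `NLP(t)`. -/
def Zreg (t : ℝ) : Set (Euc n × Euc n) :=
  {z | (∀ i, P.g i z.1 ≤ 0) ∧ (∀ i, P.h i z.1 = 0) ∧
    (∀ i, 0 ≤ z.2 i ∧ z.2 i ≤ 1) ∧ (n : ℝ) - (P.κ : ℝ) ≤ ∑ i, z.2 i ∧
    ∀ i, -t ≤ z.1 i * z.2 i ∧ z.1 i * z.2 i ≤ t}

/-! Index sets. -/

/-- `I_g(x)`: active inequality constraints. -/
def Ig (x : Euc n) : Finset (Fin m) := Finset.univ.filter fun i => P.g i x = 0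

end CCProblem

/-- `I_0(x)`. -/
def Izero {n : ℕ} (x : Euc n) : Finset (Fin n) := Finset.univ.filter fun i => x i = 0

/-- `I_{±0}(x,y)`. -/
def Ipm0 {n : ℕ} (z : Euc n × Euc n) : Finset (Fin n) :=
  Finset.univ.filter fun i => z.1 i ≠ 0 ∧ z.2 i = 0

/-- `I_{00}(x,y)`. -/
def I00 {n : ℕ} (z : Euc n × Euc n) : Finset (Fin n) :=
  Finset.univ.filter fun i => z.1 i = 0 ∧ z.2 i = 0

/-- `I_{0+}(x,y)`. -/
def I0plus {n : ℕ} (z : Euc n × Euc n) : Finset (Fin n) :=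
  Finset.univ.filter fun i => z.1 i = 0 ∧ 0 < z.2 i ∧ z.2 i < 1

/-- `I_{01}(x,y)`. -/
def I01 {n : ℕ} (z : Euc n × Euc n) : Finset (Fin n) :=
  Finset.univ.filter fun i => z.1 i = 0 ∧ z.2 i = 1

namespace CCProblem

variable {n m p : ℕ} (P : CCProblem n m p)

/-- CC-MFCQ at `x`: the gradients `∇g_i(x)` (`i ∈ I_g(x)`) and
`∇h_i(x)` (all `i`), `e_i` (`i ∈ I_0(x)`) are positively linearly independent. -/
def CCMFCQ (x : Euc n) : Prop :=
  ¬ PosLinDep (fun i : {i // i ∈ P.Ig x} => gradient (P.g i.1) x)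
    (Sum.elim (fun j : Fin p => gradient (P.h j) x)
      (fun i : {i // i ∈ Izero x} => (EuclideanSpace.single i.1 (1 : ℝ) : Euc n)))

/-- `(lam, mu, gam)` is an M-stationary multiplier of `z = (x, y)`. -/
def IsMMultiplier (z : Euc n × Euc n)
    (lam : Fin m → ℝ) (mu : Fin p → ℝ) (gam : Fin n → ℝ) : Prop :=
  gradient P.f z.1 + ∑ i, lam i • gradient (P.g i) z.1 + ∑ j, mu j • gradient (P.h j) z.1
      + ∑ i, gam i • (EuclideanSpace.single i (1 : ℝ) : Euc n) = 0 ∧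
    (∀ i, 0 ≤ lam i ∧ lam i * P.g i z.1 = 0) ∧
    ∀ i ∈ Ipm0 z, gam i = 0

/-- `(lam, mu, gam)` is an S-stationary multiplier of `z = (x, y)`. -/
def IsSMultiplier (z : Euc n × Euc n)
    (lam : Fin m → ℝ) (mu : Fin p → ℝ) (gam : Fin n → ℝ) : Prop :=
  P.IsMMultiplier z lam mu gam ∧ ∀ i ∈ I00 z, gam i = 0

/-- `(lam, mu, gam)` is an M-stationary multiplier of `x`, i.e. of `(x, y)` for some `y` with
`(x, y) ∈ Z` (equivalently for all such `y`). -/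
def IsMMultiplierOf (x : Euc n)
    (lam : Fin m → ℝ) (mu : Fin p → ℝ) (gam : Fin n → ℝ) : Prop :=
  ∃ y : Euc n, (x, y) ∈ P.Z ∧ P.IsMMultiplier (x, y) lam mu gam

/-- `z = (x, y)` is an S-stationary point of the reformulation. -/
def IsSStationary (z : Euc n × Euc n) : Prop :=
  z ∈ P.Z ∧ ∃ lam mu gam, P.IsSMultiplier z lam mu gam

/-- The CC-linearisation cone of `Z` at `z = (x, y)`. -/
def linCone (z : Euc n × Euc n) : Set (Euc n × Euc n) :=
  {d | (∀ i ∈ P.Ig z.1, inner ℝ (gradient (P.g i) z.1) d.1 ≤ 0) ∧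
    (∀ j, inner ℝ (gradient (P.h j) z.1) d.1 = 0) ∧
    (∑ i, z.2 i = (n : ℝ) - (P.κ : ℝ) → 0 ≤ ∑ i, d.2 i) ∧
    (∀ i ∈ Ipm0 z, d.2 i = 0) ∧
    (∀ i ∈ I00 z, 0 ≤ d.2 i) ∧
    (∀ i ∈ I01 z, d.2 i ≤ 0) ∧
    (∀ i ∈ I01 z ∪ I0plus z, d.1 i = 0) ∧
    ∀ i ∈ I00 z, d.1 i * d.2 i = 0}

/-- The CC-critical cone of `Z` at `z = (x, y)`. -/
def critCone (z : Euc n × Euc n) : Set (Euc n × Euc n) :=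
  P.linCone z ∩ {d | inner ℝ (gradient P.f z.1) d.1 ≤ 0}

/-- The linearisation cone of the original feasible set at `x`. -/
def linConeX (x : Euc n) : Set (Euc n) :=
  {dx | ∃ y dy : Euc n, (x, y) ∈ P.Z ∧ (dx, dy) ∈ P.linCone (x, y)}

/-- The critical cone of the original feasible set at `x`. -/
def critConeX (x : Euc n) : Set (Euc n) :=
  {dx | dx ∈ P.linConeX x ∧ inner ℝ (gradient P.f x) dx ≤ 0}

/-- `dᵀ (∇²f(x) + ∑ lam_i ∇²g_i(x) + ∑ mu_j ∇²h_j(x)) d`. -/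
def lagHessForm (x : Euc n) (lam : Fin m → ℝ) (mu : Fin p → ℝ) (d : Euc n) : ℝ :=
  hessForm P.f x d + ∑ i, lam i * hessForm (P.g i) x d + ∑ j, mu j * hessForm (P.h j) x d

/-- Strict local minimizer of the cardinality constrained problem. -/
def IsStrictLocalMinCC (x : Euc n) : Prop :=
  x ∈ P.ccFeasible ∧ ∃ r > 0, ∀ x' ∈ Metric.ball x r, x' ∈ P.ccFeasible → x' ≠ x → P.f x < P.f x'

/-- Strict local minimum with respect to `x` of the reformulation. -/
def IsStrictLocalMinWrtX (z : Euc n × Euc n) : Prop :=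
  z ∈ P.Z ∧ ∃ r > 0, ∀ z' ∈ Metric.ball z r, z' ∈ P.Z → z'.1 ≠ z.1 → P.f z.1 < P.f z'.1

/-- Local minimum of `NLP(t)`. -/
def IsLocalMinReg (t : ℝ) (z : Euc n × Euc n) : Prop :=
  z ∈ P.Zreg t ∧ IsLocalMinOn (fun w : Euc n × Euc n => P.f w.1) (P.Zreg t) z

/-- KKT point of `NLP(t)`. The multipliers belong to the constraints as follows:
`lam` to `g ≤ 0`, `mu` to `h = 0`, `nuL` to `-y ≤ 0`, `nuU` to `y - e ≤ 0`,
`del` to `n - κ - eᵀy ≤ 0`, `gamU` to `x ∘ y - t e ≤ 0` and `gamL` to `-t e - x ∘ y ≤ 0`.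
The first two equations are the `x`-part and the `y`-part of the vanishing of the gradient of the
Lagrangian; the remaining conditions are dual feasibility and complementarity. -/
def IsKKTReg (t : ℝ) (z : Euc n × Euc n) : Prop :=
  z ∈ P.Zreg t ∧
  ∃ (lam : Fin m → ℝ) (mu : Fin p → ℝ) (nuL nuU : Fin n → ℝ) (del : ℝ) (gamL gamU : Fin n → ℝ),
    (gradient P.f z.1 + ∑ i, lam i • gradient (P.g i) z.1 + ∑ j, mu j • gradient (P.h j) z.1
      + ∑ i, ((gamU i - gamL i) * z.2 i) • (EuclideanSpace.single i (1 : ℝ) : Euc n) = 0) ∧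
    (∀ i, (gamU i - gamL i) * z.1 i + nuU i - nuL i - del = 0) ∧
    (∀ i, 0 ≤ lam i ∧ lam i * P.g i z.1 = 0) ∧
    (∀ i, 0 ≤ nuL i ∧ nuL i * z.2 i = 0) ∧
    (∀ i, 0 ≤ nuU i ∧ nuU i * (z.2 i - 1) = 0) ∧
    (0 ≤ del ∧ del * ((n : ℝ) - (P.κ : ℝ) - ∑ i, z.2 i) = 0) ∧
    (∀ i, 0 ≤ gamU i ∧ gamU i * (z.1 i * z.2 i - t) = 0) ∧
    (∀ i, 0 ≤ gamL i ∧ gamL i * (-t - z.1 i * z.2 i) = 0)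

/-- All objective and constraint functions are `k` times continuously differentiable. -/
def Smooth (k : ℕ) : Prop :=
  ContDiff ℝ k P.f ∧ (∀ i, ContDiff ℝ k (P.g i)) ∧ ∀ j, ContDiff ℝ k (P.h j)

end CCProblem

end

/-! In NLP(t) let γ_i be the difference of the upper and lower multipliers of -t ≤ x_i y_i ≤ t. The
x-part of the KKT system is then the M-stationarity equation with γ_i y_i as sparsity multipliers,
and what must be shown is that these products die out wherever y tends to 0. This is
`YMultSystem.exists_dominating`: the y-part gives γ_i x_i = δ as soon as 0 < y_i < 1, and together
with |x_i y_i| = t this yields |γ_i y_i| = δ y_i² / t. The cardinality constraint always leaves such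
an index i whose y_i stays away from 0, so γ_j y_j is negligible against the whole multiplier vector
whenever y_j → 0.

CC-MFCQ, in the dual form `NoAbnormalMult`, then bounds the multipliers by the objective multiplier:
otherwise normalised multipliers would converge to a nonzero abnormal one
(`NoAbnormalMult.exists_norm_le`). With objective multiplier 1 this gives convergent multipliers
whose limit vanishes on I_{±0} and I_{00}, which is S-stationarity in (b). With objective multiplier
0 it shows that Fritz John points near x* are KKT points. For (a), minimise f over the part of the
feasible set of NLP(t) with x in a small closed ball. Strictness drives the minimisers to x* as t →
0, so they become local minima, and they satisfy the Fritz John conditions, which are proved here by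
a quadratic penalty.

For (c) and (d), suppose that S-stationary points with x_k ≠ x* approached x*. A limit d of the
normalised differences is critical, and subtracting the stationarity equations at x_k and x* shows
nonpositive curvature of a limiting Lagrangian along d (`exists_critical_direction`), against the
second-order condition. Hence S-stationary points near x* lie over x*, and by (b) every KKT sequence
near x* has its x-part converging to x*. If ‖x*‖₀ = κ, then y* is the only admissible y, so (c)
reduces to (d) and y converges too. -/

theorem hasDerivAt_max_zero_sq (s : ℝ) :
    HasDerivAt (fun s : ℝ => (max s 0) ^ 2) (2 * max s 0) s := by
  rcases lt_trichotomy s 0 with h | h | h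
  · have : (fun s : ℝ => (max s 0) ^ 2) =ᶠ[𝓝 s] fun _ => 0 := by
      filter_upwards [gt_mem_nhds h] with a ha
      simp [max_eq_right ha.le]
    rw [max_eq_right h.le, mul_zero]
    exact (hasDerivAt_const s (0 : ℝ)).congr_of_eventuallyEq this
  · subst h
    rw [hasDerivAt_iff_isLittleO_nhds_zero]
    have h2 : (fun h : ℝ => h ^ 2) =o[𝓝 0] fun h : ℝ => h := by
      simpa using Asymptotics.isLittleO_pow_pow (𝕜 := ℝ) (m := 1) (n := 2) (by norm_num)
    refine Asymptotics.IsBigO.trans_isLittleO (Asymptotics.IsBigO.of_bound 1 ?_) h2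
    refine Eventually.of_forall fun a => ?_
    rcases le_total a 0 with ha | ha <;> simp [ha]
    positivity
  · have : (fun s : ℝ => (max s 0) ^ 2) =ᶠ[𝓝 s] fun s => s ^ 2 := by
      filter_upwards [lt_mem_nhds h] with a ha
      simp [max_eq_left ha.le]
    rw [max_eq_left h.le]
    have h3 : HasDerivAt (fun s : ℝ => s ^ 2) (2 * s) s := by
      simpa using hasDerivAt_pow 2 s
    exact h3.congr_of_eventuallyEq this

/-! ### Fritz John conditions by quadratic penalties -/

section FritzJohn

variable {E : Type*} {ι ι' : Type*} [Fintype ι] [Fintype ι']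

/-- The quadratic penalty of the constraints `g ≤ 0`, `h = 0`. -/
def quadPenalty (g : ι → E → ℝ) (h : ι' → E → ℝ) (z : E) : ℝ :=
  ∑ i, (max (g i z) 0) ^ 2 + ∑ j, (h j z) ^ 2

theorem quadPenalty_nonneg (g : ι → E → ℝ) (h : ι' → E → ℝ) (z : E) :
    0 ≤ quadPenalty g h z := by
  unfold quadPenalty; positivity

theorem feasible_of_quadPenalty_eq_zero {g : ι → E → ℝ} {h : ι' → E → ℝ} {z : E}
    (hz : quadPenalty g h z = 0) : (∀ i, g i z ≤ 0) ∧ ∀ j, h j z = 0 := by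
  unfold quadPenalty at hz
  have h1 : ∑ i, (max (g i z) 0) ^ 2 = 0 := by
    apply le_antisymm _ (by positivity)
    have : 0 ≤ ∑ j, (h j z) ^ 2 := by positivity
    linarith
  have h2 : ∑ j, (h j z) ^ 2 = 0 := by linarith
  rw [Finset.sum_eq_zero_iff_of_nonneg (fun _ _ => by positivity)] at h1 h2
  refine ⟨fun i => ?_, fun j => ?_⟩
  · have := h1 i (Finset.mem_univ _)
    simpa using this
  · simpa using h2 j (Finset.mem_univ _)

theorem quadPenalty_eq_zero_of_feasible {g : ι → E → ℝ} {h : ι' → E → ℝ} {z : E}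
    (hg : ∀ i, g i z ≤ 0) (hh : ∀ j, h j z = 0) : quadPenalty g h z = 0 := by
  simp [quadPenalty, hg, hh]

theorem continuous_quadPenalty [TopologicalSpace E] {g : ι → E → ℝ} {h : ι' → E → ℝ}
    (hg : ∀ i, Continuous (g i)) (hh : ∀ j, Continuous (h j)) :
    Continuous (quadPenalty g h) := by
  unfold quadPenalty; fun_prop

theorem hasFDerivAt_quadPenalty [NormedAddCommGroup E] [NormedSpace ℝ E]
    {g : ι → E → ℝ} {h : ι' → E → ℝ} {z : E}
    (hg : ∀ i, DifferentiableAt ℝ (g i) z) (hh : ∀ j, DifferentiableAt ℝ (h j) z) :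
    HasFDerivAt (quadPenalty g h)
      (∑ i, (2 * max (g i z) 0) • fderiv ℝ (g i) z + ∑ j, (2 * h j z) • fderiv ℝ (h j) z) z := by
  unfold quadPenalty
  refine HasFDerivAt.add ?_ ?_
  · refine HasFDerivAt.fun_sum fun i _ => ?_
    exact (hasDerivAt_max_zero_sq (g i z)).comp_hasFDerivAt z (hg i).hasFDerivAt
  · refine HasFDerivAt.fun_sum fun j _ => ?_
    have := (hh j).hasFDerivAt.pow 2
    simpa using this

variable [NormedAddCommGroup E] [NormedSpace ℝ E] [FiniteDimensional ℝ E]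

/-- Local minimizers are approximate Karush–Kuhn–Tucker points. -/
theorem exists_approx_kkt {f : E → ℝ} {g : ι → E → ℝ} {h : ι' → E → ℝ}
    (hf : ContDiff ℝ 1 f) (hg : ∀ i, ContDiff ℝ 1 (g i)) (hh : ∀ j, ContDiff ℝ 1 (h j)) {x : E}
    (hgx : ∀ i, g i x ≤ 0) (hhx : ∀ j, h j x = 0)
    (hmin : IsLocalMinOn f {z | (∀ i, g i z ≤ 0) ∧ ∀ j, h j z = 0} x) :
    ∃ (u : ℕ → E) (lam : ℕ → ι → ℝ) (mu : ℕ → ι' → ℝ) (e : ℕ → E →L[ℝ] ℝ),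
      Tendsto u atTop (𝓝 x) ∧ Tendsto e atTop (𝓝 0) ∧ (∀ k i, 0 ≤ lam k i) ∧
      (∀ k i, g i (u k) < 0 → lam k i = 0) ∧
      ∀ᶠ k in atTop, fderiv ℝ f (u k) + e k + ∑ i, lam k i • fderiv ℝ (g i) (u k)
        + ∑ j, mu k j • fderiv ℝ (h j) (u k) = 0 := by
  -- The proximal term singles out x among all minimisers and has zero derivative there. The norm of
  -- E need not come from an inner product (the sup norm on a product does not), so `toEuclidean`
  -- supplies a smooth squared norm.
  set φ : E → ℝ := fun z => ‖toEuclidean (z - x)‖ ^ 2 with hφ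
  have hφc : ContDiff ℝ 1 φ :=
    ((toEuclidean (E := E)).contDiff.comp (contDiff_id.sub contDiff_const)).norm_sq ℝ
  have hφ0 : φ x = 0 := by simp [hφ]
  have hφnn : ∀ z, 0 ≤ φ z := fun z => by positivity
  have hφz : ∀ z, φ z = 0 → z = x := by
    intro z hz
    have : toEuclidean (z - x) = 0 := by simpa only [hφ, sq_eq_zero_iff, norm_eq_zero] using hz
    exact sub_eq_zero.1 ((map_eq_zero_iff _ (toEuclidean (E := E)).injective).1 this)
  have hφd : fderiv ℝ φ x = 0 :=
    IsLocalMin.fderiv_eq_zero (Eventually.of_forall fun z => by rw [hφ0]; exact hφnn z)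
  obtain ⟨r, hr, hball⟩ : ∃ r > 0, ∀ z ∈ Metric.closedBall x r,
      (∀ i, g i z ≤ 0) → (∀ j, h j z = 0) → f x ≤ f z := by
    have := eventually_nhdsWithin_iff.1 hmin
    obtain ⟨r, hr, hb⟩ := Metric.nhds_basis_closedBall.eventually_iff.1 this
    exact ⟨r, hr, fun z hz h1 h2 => hb hz ⟨h1, h2⟩⟩
  have hK : IsCompact (Metric.closedBall x r) := isCompact_closedBall x r
  have hxK : x ∈ Metric.closedBall x r := Metric.mem_closedBall_self hr.le
  have hqc : Continuous (quadPenalty g h) :=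
    continuous_quadPenalty (fun i => (hg i).continuous) (fun j => (hh j).continuous)
  have hex : ∀ k : ℕ, ∃ u ∈ Metric.closedBall x r, IsMinOn
      (fun z => f z + φ z + k * quadPenalty g h z) (Metric.closedBall x r) u := fun k =>
    hK.exists_isMinOn ⟨x, hxK⟩
      ((hf.continuous.add hφc.continuous).add (continuous_const.mul hqc)).continuousOn
  choose u huK humin using hex
  have hval : ∀ k : ℕ, f (u k) + φ (u k) + k * quadPenalty g h (u k) ≤ f x := by
    intro k
    have := humin k hxK
    simpa [hφ0, quadPenalty_eq_zero_of_feasible hgx hhx] using this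
  obtain ⟨B, hB⟩ : ∃ B, ∀ z ∈ Metric.closedBall x r, B ≤ f z :=
    (hK.bddBelow_image hf.continuous.continuousOn).imp fun B hB z hz => hB ⟨z, hz, rfl⟩
  have hq0 : Tendsto (fun k => quadPenalty g h (u k)) atTop (𝓝 0) := by
    refine squeeze_zero' (g := fun k : ℕ => (f x - B) / k)
      (Eventually.of_forall fun k => quadPenalty_nonneg g h _) ?_
      (tendsto_const_div_atTop_nhds_zero_nat _)
    filter_upwards [eventually_gt_atTop 0] with k hk
    rw [le_div_iff₀ (by exact_mod_cast hk)]
    have := hval k; have := hB _ (huK k); have := hφnn (u k)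
    linarith
  have hu : Tendsto u atTop (𝓝 x) := by
    -- A cluster point z is feasible since the penalty tends to 0, so f z + φ z ≤ f x ≤ f z, which
    -- forces φ z = 0.
    refine hK.tendsto_nhds_of_unique_mapClusterPt (Eventually.of_forall huK) ?_
    intro z hz hzc
    obtain ⟨ψ, hψ, hlim⟩ := hzc.tendsto_subseq
    have hqz : quadPenalty g h z = 0 :=
      tendsto_nhds_unique ((hqc.tendsto z).comp hlim) (hq0.comp hψ.tendsto_atTop)
    obtain ⟨h1, h2⟩ := feasible_of_quadPenalty_eq_zero hqz
    have h3 := hball z hz h1 h2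
    have h4 : f z + φ z ≤ f x := by
      refine le_of_tendsto (((hf.continuous.add hφc.continuous).tendsto z).comp hlim)
        (Eventually.of_forall fun k => ?_)
      have := hval (ψ k)
      have h5 : 0 ≤ (ψ k : ℝ) * quadPenalty g h (u (ψ k)) :=
        mul_nonneg (Nat.cast_nonneg _) (quadPenalty_nonneg g h _)
      simp only [Function.comp, Pi.add_apply]
      linarith
    exact hφz z (le_antisymm (by linarith) (hφnn z))
  refine ⟨u, fun k i => k * (2 * max (g i (u k)) 0), fun k j => k * (2 * h j (u k)),
    fun k => fderiv ℝ φ (u k), hu, ?_, fun k i => by positivity, fun k i hi => by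
      simp [max_eq_right hi.le], ?_⟩
  · have := ((hφc.continuous_fderiv one_ne_zero).tendsto x).comp hu
    rwa [hφd] at this
  · filter_upwards [hu.eventually (Metric.ball_mem_nhds x hr)] with k hk
    have hd : HasFDerivAt (fun z => f z + φ z + k * quadPenalty g h z) _ (u k) :=
      (((hf.differentiable one_ne_zero _).hasFDerivAt).add
        ((hφc.differentiable one_ne_zero _).hasFDerivAt)).add
        ((hasFDerivAt_quadPenalty (fun i => (hg i).differentiable one_ne_zero _)
          (fun j => (hh j).differentiable one_ne_zero _)).const_mul (k : ℝ))
    have hloc : IsLocalMin (fun z => f z + φ z + k * quadPenalty g h z) (u k) :=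
      (humin k).isLocalMin (Filter.mem_of_superset (Metric.isOpen_ball.mem_nhds hk)
        Metric.ball_subset_closedBall)
    have := hloc.hasFDerivAt_eq_zero hd
    rw [smul_add, Finset.smul_sum, Finset.smul_sum] at this
    simp only [smul_smul] at this
    rw [← add_assoc] at this
    exact this

/-- The Fritz John necessary optimality conditions. -/
theorem exists_fritzJohn_multipliers {f : E → ℝ} {g : ι → E → ℝ} {h : ι' → E → ℝ}
    (hf : ContDiff ℝ 1 f) (hg : ∀ i, ContDiff ℝ 1 (g i)) (hh : ∀ j, ContDiff ℝ 1 (h j)) {x : E}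
    (hgx : ∀ i, g i x ≤ 0) (hhx : ∀ j, h j x = 0)
    (hmin : IsLocalMinOn f {z | (∀ i, g i z ≤ 0) ∧ ∀ j, h j z = 0} x) :
    ∃ (α : ℝ) (lam : ι → ℝ) (mu : ι' → ℝ), 0 ≤ α ∧ (∀ i, 0 ≤ lam i ∧ lam i * g i x = 0) ∧
      (α, lam, mu) ≠ 0 ∧ α • fderiv ℝ f x + ∑ i, lam i • fderiv ℝ (g i) x
        + ∑ j, mu j • fderiv ℝ (h j) x = 0 := by
  obtain ⟨u, lam, mu, e, hu, he, hlam, hcomp, hstat⟩ := exists_approx_kkt hf hg hh hgx hhx hmin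
  -- The entry 1 belongs to the objective; it keeps the vector away from 0 and becomes α after
  -- normalisation, possibly 0 in the limit.
  set w : ℕ → ℝ × (ι → ℝ) × (ι' → ℝ) := fun k => (1, lam k, mu k) with hw
  have hwpos : ∀ k, 1 ≤ ‖w k‖ := fun k => by
    simp [hw]
  have hmem : ∀ k, ‖w k‖⁻¹ • w k ∈ Metric.sphere (0 : ℝ × (ι → ℝ) × (ι' → ℝ)) 1 := fun k => by
    have : ‖w k‖ ≠ 0 := by have := hwpos k; positivity
    simp [norm_smul, this]
  obtain ⟨v, hv, ψ, hψ, hlim⟩ := (isCompact_sphere (0 : ℝ × (ι → ℝ) × (ι' → ℝ)) 1).tendsto_subseq hmem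
  have hlim1 : Tendsto (fun k => ‖w (ψ k)‖⁻¹) atTop (𝓝 v.1) := by
    have := (continuous_fst.tendsto v).comp hlim
    simpa [Function.comp_def, hw] using this
  have hlim2 : ∀ i, Tendsto (fun k => ‖w (ψ k)‖⁻¹ * lam (ψ k) i) atTop (𝓝 (v.2.1 i)) := fun i =>
    (((continuous_apply i).comp (continuous_fst.comp continuous_snd)).tendsto v).comp hlim
  have hlim3 : ∀ j, Tendsto (fun k => ‖w (ψ k)‖⁻¹ * mu (ψ k) j) atTop (𝓝 (v.2.2 j)) := fun j =>
    (((continuous_apply j).comp (continuous_snd.comp continuous_snd)).tendsto v).comp hlim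
  have huψ := hu.comp hψ.tendsto_atTop
  refine ⟨v.1, v.2.1, v.2.2, ge_of_tendsto' hlim1 fun k => by positivity, fun i =>
    ⟨ge_of_tendsto' (hlim2 i) fun k => mul_nonneg (by positivity) (hlam _ _), ?_⟩, ?_, ?_⟩
  · rcases (hgx i).lt_or_eq with hi | hi
    · have h1 : ∀ᶠ k in atTop, g i (u (ψ k)) < 0 :=
        (((hg i).continuous.tendsto x).comp huψ).eventually (gt_mem_nhds hi)
      have h2 : v.2.1 i = 0 := by
        refine tendsto_nhds_unique (hlim2 i) (tendsto_const_nhds.congr' ?_)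
        filter_upwards [h1] with k hk
        rw [hcomp _ _ hk, mul_zero]
      rw [h2, zero_mul]
    · rw [hi, mul_zero]
  · intro h0
    have : v = 0 := h0
    simp [this] at hv
  · have hlimall : Tendsto (fun k => ‖w (ψ k)‖⁻¹ • fderiv ℝ f (u (ψ k)) + ‖w (ψ k)‖⁻¹ • e (ψ k)
        + ∑ i, (‖w (ψ k)‖⁻¹ * lam (ψ k) i) • fderiv ℝ (g i) (u (ψ k))
        + ∑ j, (‖w (ψ k)‖⁻¹ * mu (ψ k) j) • fderiv ℝ (h j) (u (ψ k))) atTop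
        (𝓝 (v.1 • fderiv ℝ f x + v.1 • (0 : E →L[ℝ] ℝ) + ∑ i, v.2.1 i • fderiv ℝ (g i) x
          + ∑ j, v.2.2 j • fderiv ℝ (h j) x)) := by
      refine ((Tendsto.add (hlim1.smul ?_) (hlim1.smul (he.comp hψ.tendsto_atTop))).add
        (tendsto_finsetSum _ fun i _ => (hlim2 i).smul ?_)).add
        (tendsto_finsetSum _ fun j _ => (hlim3 j).smul ?_)
      · exact ((hf.continuous_fderiv one_ne_zero).tendsto x).comp huψ
      · exact (((hg i).continuous_fderiv one_ne_zero).tendsto x).comp huψ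
      · exact (((hh j).continuous_fderiv one_ne_zero).tendsto x).comp huψ
    rw [smul_zero, add_zero] at hlimall
    refine tendsto_nhds_unique hlimall (tendsto_const_nhds.congr' ?_)
    filter_upwards [hψ.tendsto_atTop.eventually hstat] with k hk
    simp only [mul_smul, ← Finset.smul_sum, ← smul_add]
    rw [hk, smul_zero]

end FritzJohn

/-! ### CC-MFCQ in dual form and bounds on multipliers -/

noncomputable section

/-- Multipliers of the inequality, equality and sparsity constraints. -/
abbrev Mult (m p n : ℕ) : Type := (Fin m → ℝ) × (Fin p → ℝ) × (Fin n → ℝ)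

theorem continuous_gradient {n : ℕ} {φ : Euc n → ℝ} (hφ : ContDiff ℝ 1 φ) :
    Continuous (gradient φ) :=
  (InnerProductSpace.toDual ℝ (Euc n)).symm.continuous.comp (hφ.continuous_fderiv one_ne_zero)

theorem inner_gradient_eq {n : ℕ} (φ : Euc n → ℝ) (x d : Euc n) :
    inner ℝ (gradient φ x) d = fderiv ℝ φ x d := by
  simp [gradient]

namespace CCProblem

variable {n m p : ℕ} (P : CCProblem n m p)

/-- `α ∇f(x) + ∑ λ_i ∇g_i(x) + ∑ μ_j ∇h_j(x) + ∑ η_i e_i`. -/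
def statVec (α : ℝ) (w : Mult m p n) (x : Euc n) : Euc n :=
  α • gradient P.f x + ∑ i, w.1 i • gradient (P.g i) x + ∑ j, w.2.1 j • gradient (P.h j) x
    + ∑ i, w.2.2 i • (EuclideanSpace.single i (1 : ℝ) : Euc n)

variable {P}

theorem continuous_statVec (hP : P.Smooth 1) :
    Continuous fun q : ℝ × Mult m p n × Euc n => P.statVec q.1 q.2.1 q.2.2 := by
  have hf := continuous_gradient hP.1
  have hg := fun i => continuous_gradient (hP.2.1 i)
  have hh := fun j => continuous_gradient (hP.2.2 j)
  unfold statVec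
  fun_prop

theorem smul_statVec (c α : ℝ) (w : Mult m p n) (x : Euc n) :
    c • P.statVec α w x = P.statVec (c * α) (c • w) x := by
  simp [statVec, smul_add, Finset.smul_sum, smul_smul]

theorem inner_statVec (α : ℝ) (w : Mult m p n) (x d : Euc n) :
    inner ℝ (P.statVec α w x) d = α * fderiv ℝ P.f x d + ∑ i, w.1 i * fderiv ℝ (P.g i) x d
      + ∑ j, w.2.1 j * fderiv ℝ (P.h j) x d + ∑ i, w.2.2 i * d i := by
  simp [statVec, inner_add_left, sum_inner, inner_smul_left,
    EuclideanSpace.inner_single_left]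

variable (P) in
/-- The multiplier form of CC-MFCQ: the only abnormal multiplier is zero. -/
def NoAbnormalMult (x : Euc n) : Prop :=
  ∀ w : Mult m p n, (∀ i, 0 ≤ w.1 i ∧ w.1 i * P.g i x = 0) → (∀ i, x i ≠ 0 → w.2.2 i = 0) →
    P.statVec 0 w x = 0 → w = 0

/-- Multipliers of full length live in one fixed space, where limits can be taken; complementarity
makes them vanish off the active sets, so they restrict to the families in CC-MFCQ without changing
the sums. -/
theorem CCMFCQ.noAbnormalMult {x : Euc n} (hx : P.CCMFCQ x) : P.NoAbnormalMult x := by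
  intro w hw1 hw2 hw3
  by_contra hne
  apply hx
  have hg0 : ∀ i, i ∉ P.Ig x → w.1 i = 0 := by
    intro i hi
    have : P.g i x ≠ 0 := by simpa [Ig] using hi
    exact (mul_eq_zero.1 (hw1 i).2).resolve_right this
  have hx0 : ∀ i, i ∉ Izero x → w.2.2 i = 0 := by
    intro i hi
    exact hw2 i (by simpa [Izero] using hi)
  refine ⟨fun i => w.1 i, Sum.elim w.2.1 fun i => w.2.2 i, fun i => (hw1 i).1, ?_, ?_⟩
  · intro h0
    apply hne
    obtain ⟨h1, h2⟩ := Prod.mk_eq_zero.1 h0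
    have e1 : w.1 = 0 := by
      funext i
      by_cases hi : i ∈ P.Ig x
      · exact congrFun h1 ⟨i, hi⟩
      · exact hg0 i hi
    have e2 : w.2.1 = 0 := by
      funext j
      exact congrFun h2 (Sum.inl j)
    have e3 : w.2.2 = 0 := by
      funext i
      by_cases hi : i ∈ Izero x
      · exact congrFun h2 (Sum.inr ⟨i, hi⟩)
      · exact hx0 i hi
    exact Prod.ext e1 (Prod.ext e2 e3)
  · rw [Fintype.sum_sum_type]
    simp only [Sum.elim_inl, Sum.elim_inr]
    have s1 : ∑ i : {i // i ∈ P.Ig x}, w.1 i • gradient (P.g i) x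
        = ∑ i, w.1 i • gradient (P.g i) x := by
      rw [Finset.sum_coe_sort (P.Ig x) (fun i => w.1 i • gradient (P.g i) x)]
      exact Finset.sum_subset (Finset.subset_univ _) fun i _ hi => by rw [hg0 i hi, zero_smul]
    have s2 : ∑ i : {i // i ∈ Izero x}, w.2.2 i • (EuclideanSpace.single i.1 (1 : ℝ) : Euc n)
        = ∑ i, w.2.2 i • (EuclideanSpace.single i (1 : ℝ) : Euc n) := by
      rw [Finset.sum_coe_sort (Izero x)
        (fun i => w.2.2 i • (EuclideanSpace.single i (1 : ℝ) : Euc n))]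
      exact Finset.sum_subset (Finset.subset_univ _) fun i _ hi => by rw [hx0 i hi, zero_smul]
    rw [s1, s2, ← add_assoc]
    simpa [statVec] using hw3

/-- Multipliers along a sequence converging to a point without abnormal multipliers are bounded
by the multiplier of the objective. -/
theorem NoAbnormalMult.exists_norm_le (hP : P.Smooth 1) {xb : Euc n} (hreg : P.NoAbnormalMult xb)
    {x : ℕ → Euc n} (hx : Tendsto x atTop (𝓝 xb)) {α : ℕ → ℝ} (hα : ∀ k, 0 ≤ α k)
    {w : ℕ → Mult m p n} (hw : ∀ k i, 0 ≤ (w k).1 i ∧ (w k).1 i * P.g i (x k) = 0)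
    (hdom : ∀ j, xb j ≠ 0 → ∀ ε > 0, ∀ᶠ k in atTop, |(w k).2.2 j| ≤ ε * ‖w k‖)
    (hstat : ∀ k, P.statVec (α k) (w k) (x k) = 0) :
    ∃ C, ∀ᶠ k in atTop, ‖w k‖ ≤ C * α k := by
  by_contra hcon
  push Not at hcon
  -- If no constant works, some subsequence has α_k / ‖w_k‖ → 0; a limit of w_k / ‖w_k‖ is then an
  -- abnormal multiplier of norm 1.
  obtain ⟨ψ, hψ, hlt⟩ := extraction_forall_of_frequently fun N : ℕ => hcon N
  have hpos : ∀ k, 0 < ‖w (ψ k)‖ := fun k =>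
    (mul_nonneg (Nat.cast_nonneg k) (hα _)).trans_lt (hlt k)
  have hmem : ∀ k, ‖w (ψ k)‖⁻¹ • w (ψ k) ∈ Metric.sphere (0 : Mult m p n) 1 := fun k => by
    simp [norm_smul, (hpos k).ne']
  obtain ⟨v, hv, χ, hχ, hlim⟩ := (isCompact_sphere (0 : Mult m p n) 1).tendsto_subseq hmem
  have hψχ : Tendsto (fun k => ψ (χ k)) atTop atTop :=
    hψ.tendsto_atTop.comp hχ.tendsto_atTop
  have hxs : Tendsto (fun k => x (ψ (χ k))) atTop (𝓝 xb) := hx.comp hψχ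
  have hα0 : Tendsto (fun k => ‖w (ψ k)‖⁻¹ * α (ψ k)) atTop (𝓝 0) := by
    refine squeeze_zero' (Eventually.of_forall fun k => by have := hα (ψ k); positivity) ?_
      (tendsto_const_div_atTop_nhds_zero_nat 1)
    filter_upwards [eventually_gt_atTop 0] with k hk
    have hk' : (0 : ℝ) < k := by exact_mod_cast hk
    rw [inv_mul_eq_div, div_le_div_iff₀ (hpos k) hk']
    linarith [hlt k, mul_comm (α (ψ k)) k]
  have hv1 : ∀ i, Tendsto (fun k => ‖w (ψ (χ k))‖⁻¹ * (w (ψ (χ k))).1 i) atTop (𝓝 (v.1 i)) :=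
    fun i => (((continuous_apply i).comp continuous_fst).tendsto v).comp hlim
  have hv3 : ∀ i, Tendsto (fun k => ‖w (ψ (χ k))‖⁻¹ * (w (ψ (χ k))).2.2 i) atTop (𝓝 (v.2.2 i)) :=
    fun i => (((continuous_apply i).comp (continuous_snd.comp continuous_snd)).tendsto v).comp hlim
  have hv0 : v = 0 := by
    apply hreg v
    · intro i
      refine ⟨ge_of_tendsto' (hv1 i) fun k => mul_nonneg (by positivity) (hw _ _).1, ?_⟩
      refine tendsto_nhds_unique ((hv1 i).mul (((hP.2.1 i).continuous.tendsto xb).comp hxs))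
        (tendsto_const_nhds.congr fun k => ?_)
      simp only [Function.comp, mul_assoc, (hw _ i).2, mul_zero]
    · intro j hj
      rw [← abs_eq_zero]
      refine le_antisymm (le_of_forall_gt_imp_ge_of_dense fun ε hε => ?_) (abs_nonneg _)
      refine le_of_tendsto (hv3 j).abs ?_
      filter_upwards [hψχ.eventually (hdom j hj ε hε)] with k hk
      rw [abs_mul, abs_of_nonneg (by positivity), inv_mul_le_iff₀ (hpos _), mul_comm]
      exact hk
    · have h1 := ((continuous_statVec hP).tendsto (0, v, xb)).comp
        ((hα0.comp hχ.tendsto_atTop).prodMk_nhds (hlim.prodMk_nhds hxs))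
      refine tendsto_nhds_unique h1 (tendsto_const_nhds.congr fun k => ?_)
      simp only [Function.comp]
      rw [← smul_statVec, hstat, smul_zero]
  simp [hv0] at hv

/-- CC-MFCQ is stable under perturbations of the point. -/
theorem NoAbnormalMult.eventually (hP : P.Smooth 1) {xb : Euc n} (hreg : P.NoAbnormalMult xb) :
    ∀ᶠ x in 𝓝 xb, P.NoAbnormalMult x := by
  by_contra hcon
  obtain ⟨x, hx, hnot⟩ := exists_seq_forall_of_frequently (not_eventually.1 hcon)
  simp only [NoAbnormalMult, not_forall] at hnot
  choose w hw1 hw2 hw3 hne using hnot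
  -- With α = 0 the bound reads ‖w_k‖ ≤ 0, although each w_k was chosen nonzero.
  obtain ⟨C, hC⟩ := hreg.exists_norm_le hP hx (α := fun _ => 0) (fun _ => le_rfl) hw1
    (fun j hj ε _ => by
      have hxj : Tendsto (fun k => x k j) atTop (𝓝 (xb j)) :=
        (((PiLp.continuous_apply 2 _ j)).tendsto xb).comp hx
      filter_upwards [hxj.eventually_ne hj] with k hk
      rw [hw2 k j hk, abs_zero]
      positivity) hw3
  obtain ⟨k, hk⟩ := hC.exists
  exact hne k (norm_le_zero_iff.1 (by simpa using hk))

end CCProblem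

/-! ### The y-part of the KKT system of NLP(t) -/

/-- The conditions on the multipliers of `NLP(t)` coming from the derivative with respect to `y`,
with the multipliers of the two relaxed complementarity constraints combined. -/
structure YMultSystem {n : ℕ} (κ : ℕ) (t : ℝ) (x y : Euc n) (gam nuL nuU : Fin n → ℝ)
    (del : ℝ) : Prop where
  stat : ∀ i, gam i * x i + nuU i - nuL i - del = 0
  lower : ∀ i, 0 ≤ nuL i ∧ nuL i * y i = 0
  upper : ∀ i, 0 ≤ nuU i ∧ nuU i * (y i - 1) = 0
  card : 0 ≤ del ∧ del * ((n : ℝ) - (κ : ℝ) - ∑ i, y i) = 0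
  compl : ∀ i, gam i ≠ 0 → |x i * y i| = t ∧ 0 < gam i * x i

/-- At indices with 0 < y_i < 1 the box multipliers vanish, so γ_i x_i equals the common value δ and
|γ_i y_i| is proportional to y_i². Products are thus compared through the squares of y, which
explains the factor ε². In the application S is the zero set of the limit of y. -/
theorem YMultSystem.exists_dominating {n κ : ℕ} {t : ℝ} (ht : 0 < t) {x y : Euc n}
    {gam nuL nuU : Fin n → ℝ} {del : ℝ} (hs : YMultSystem κ t x y gam nuL nuU del)
    (hy : ∀ i, 0 ≤ y i ∧ y i ≤ 1) {S : Finset (Fin n)} (hS : S.card ≤ κ) {ε : ℝ}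
    {j : Fin n} (hj : j ∈ S) (hj1 : y j < 1) (hdom : ∀ i ∉ S, y j ≤ ε * y i)
    (hne : gam j * y j ≠ 0) : ∃ i ∉ S, |gam j * y j| ≤ ε ^ 2 * |gam i * y i| := by
  obtain ⟨hgj, hyj⟩ := mul_ne_zero_iff.1 hne
  have hyj0 : 0 < y j := lt_of_le_of_ne (hy j).1 (Ne.symm hyj)
  have hnu : ∀ i, 0 < y i → y i < 1 → gam i * x i = del := by
    intro i h0 h1
    have hL := (mul_eq_zero.1 (hs.lower i).2).resolve_right h0.ne'
    have hU := (mul_eq_zero.1 (hs.upper i).2).resolve_right (by linarith)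
    have := hs.stat i
    rw [hL, hU] at this
    linarith
  have hval : ∀ i, 0 < y i → y i < 1 → gam i ≠ 0 → |gam i * y i| * t = del * y i ^ 2 := by
    intro i h0 h1 hg
    rw [← (hs.compl i hg).1, ← abs_mul, show gam i * y i * (x i * y i) = gam i * x i * y i ^ 2 by ring,
      hnu i h0 h1, abs_of_nonneg (mul_nonneg hs.card.1 (sq_nonneg _))]
  have hdel : 0 < del := by
    rw [← hnu j hyj0 hj1]
    exact (hs.compl j hgj).2
  -- At y_i = 0 stationarity with γ_i = 0 would read -ν_i = δ > 0, while γ_i ≠ 0 would require |x_i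
  -- y_i| = t > 0.
  have hypos : ∀ i, 0 < y i := by
    intro i
    refine lt_of_le_of_ne (hy i).1 fun h0 => ?_
    have hU := (mul_eq_zero.1 (hs.upper i).2).resolve_right (by linarith)
    have hg : gam i ≠ 0 := by
      intro hg
      have := hs.stat i
      rw [hU, hg] at this
      linarith [(hs.lower i).1]
    have := (hs.compl i hg).1
    rw [← h0] at this
    simp at this
    linarith
  have hsum : ∑ i, y i = (n : ℝ) - κ := by
    have := (mul_eq_zero.1 hs.card.2).resolve_left hdel.ne'
    linarith
  -- If y ≥ 1 held off S, positivity of y on S would give ∑ y_i > n - |S| ≥ n - κ, but δ > 0 makes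
  -- the cardinality constraint active.
  obtain ⟨i, hiS, hi1⟩ : ∃ i ∉ S, y i < 1 := by
    by_contra hcon
    push Not at hcon
    have h1 : ∑ i ∈ Sᶜ, (1 : ℝ) ≤ ∑ i ∈ Sᶜ, y i :=
      Finset.sum_le_sum fun i hi => hcon i (Finset.mem_compl.1 hi)
    have h2 : 0 < ∑ i ∈ S, y i := Finset.sum_pos (fun i _ => hypos i) ⟨j, hj⟩
    have h3 := Finset.sum_add_sum_compl S fun i => y i
    have h4 : (S.card : ℝ) + (Sᶜ.card : ℝ) = n := by
      have := Finset.card_add_card_compl S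
      rw [Fintype.card_fin] at this
      exact_mod_cast this
    have h5 : (S.card : ℝ) ≤ κ := by exact_mod_cast hS
    simp only [Finset.sum_const, nsmul_eq_mul, mul_one] at h1
    linarith
  refine ⟨i, hiS, ?_⟩
  have hgi : gam i ≠ 0 := by
    intro h0
    have := hnu i (hypos i) hi1
    rw [h0, zero_mul] at this
    linarith
  rw [← mul_le_mul_iff_left₀ ht, mul_assoc, hval i (hypos i) hi1 hgi, hval j hyj0 hj1 hgj]
  have := pow_le_pow_left₀ (hy j).1 (hdom i hiS) 2
  calc del * y j ^ 2 ≤ del * (ε * y i) ^ 2 := by gcongr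
    _ = ε ^ 2 * (del * y i ^ 2) := by ring

/-- In the limit, the products `γ_j y_j` at indices with `y_j → 0` are negligible. -/
theorem YMultSystem.eventually_abs_le {n κ : ℕ} {t : ℕ → ℝ} (ht : ∀ k, 0 < t k)
    {x y : ℕ → Euc n} {gam nuL nuU : ℕ → Fin n → ℝ} {del : ℕ → ℝ}
    (hs : ∀ k, YMultSystem κ (t k) (x k) (y k) (gam k) (nuL k) (nuU k) (del k))
    (hy : ∀ k i, 0 ≤ y k i ∧ y k i ≤ 1) {yb : Euc n} (hlim : Tendsto y atTop (𝓝 yb))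
    (hyb : (n : ℝ) - κ ≤ ∑ i, yb i) {j : Fin n} (hj : yb j = 0) {ε : ℝ} (hε : 0 < ε) :
    ∀ᶠ k in atTop, |gam k j * y k j| ≤ ε * ‖fun i => gam k i * y k i‖ := by
  have hyi : ∀ i, Tendsto (fun k => y k i) atTop (𝓝 (yb i)) := fun i =>
    (((PiLp.continuous_apply 2 _ i)).tendsto yb).comp hlim
  have hyb0 : ∀ i, 0 ≤ yb i := fun i => ge_of_tendsto' (hyi i) fun k => (hy k i).1
  have hyb1 : ∀ i, yb i ≤ 1 := fun i => le_of_tendsto' (hyi i) fun k => (hy k i).2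
  set S : Finset (Fin n) := Finset.univ.filter fun i => yb i = 0 with hSdef
  have hS : S.card ≤ κ := by
    have h1 : ∑ i, yb i ≤ ∑ i ∈ Sᶜ, (1 : ℝ) := by
      rw [← Finset.sum_add_sum_compl S fun i => yb i,
        Finset.sum_eq_zero fun i hi => (Finset.mem_filter.1 hi).2, zero_add]
      exact Finset.sum_le_sum fun i _ => hyb1 i
    have h4 : (S.card : ℝ) + (Sᶜ.card : ℝ) = n := by
      have := Finset.card_add_card_compl S
      rw [Fintype.card_fin] at this
      exact_mod_cast this
    simp only [Finset.sum_const, nsmul_eq_mul, mul_one] at h1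
    exact_mod_cast (by linarith : (S.card : ℝ) ≤ κ)
  -- The cap at 1 ensures ε'² ≤ ε, as the domination comes with a square.
  set ε' := min 1 ε with hε'
  have hε'0 : 0 < ε' := lt_min one_pos hε
  have hsq : ε' ^ 2 ≤ ε := by
    have h1 : ε' ≤ 1 := min_le_left _ _
    have h2 : ε' ≤ ε := min_le_right _ _
    nlinarith
  have hev : ∀ᶠ k in atTop, ∀ i, i ∉ S → y k j ≤ ε' * y k i := by
    refine eventually_all.2 fun i => ?_
    by_cases hi : i ∈ S
    · exact Eventually.of_forall fun k h => absurd hi h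
    · have hpos : 0 < yb i := lt_of_le_of_ne (hyb0 i) fun h => hi (by simp [hSdef, h])
      have := (hyi j).eventually_lt ((hyi i).const_mul ε') (by rw [hj]; positivity)
      filter_upwards [this] with k hk _ using hk.le
  filter_upwards [hev, (hyi j).eventually (gt_mem_nhds (by rw [hj]; exact one_pos))] with k hk hk1
  by_cases hne : gam k j * y k j = 0
  · rw [hne, abs_zero]; positivity
  · obtain ⟨i, _, hi⟩ := (hs k).exists_dominating (ht k) (hy k) hS
      (by simp [hSdef, hj]) hk1 hk hne
    refine hi.trans (mul_le_mul hsq ?_ (abs_nonneg _) hε.le)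
    exact norm_le_pi_norm (fun i => gam k i * y k i) i

/-- Since t > 0, the two bounds on x y cannot both be active, so at most one multiplier is nonzero
and the difference determines both. As y ≥ 0, the sign of x is that of the active bound, hence that
of the difference. -/
theorem relaxed_compl {x y t gU gL : ℝ} (ht : 0 < t) (hy : 0 ≤ y)
    (hU : 0 ≤ gU ∧ gU * (x * y - t) = 0) (hL : 0 ≤ gL ∧ gL * (-t - x * y) = 0) :
    (gU - gL ≠ 0 → |x * y| = t ∧ 0 < (gU - gL) * x) ∧ (gU - gL = 0 → gU = 0 ∧ gL = 0) := by
  rcases mul_eq_zero.1 hU.2 with h1 | h1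
  · rcases mul_eq_zero.1 hL.2 with h2 | h2
    · simp [h1, h2]
    · refine ⟨fun hne => ?_, fun h => ⟨h1, by linarith⟩⟩
      have hxy : x * y = -t := by linarith
      have hx : x < 0 := by
        by_contra hx
        have := mul_nonneg (not_lt.1 hx) hy
        linarith
      have hg : 0 < gL := lt_of_le_of_ne hL.1 fun h => hne (by rw [h1, ← h, sub_zero])
      refine ⟨by rw [hxy, abs_neg, abs_of_pos ht], ?_⟩
      rw [h1]
      nlinarith
  · have hxy : x * y = t := by linarith
    have h2 : gL = 0 := (mul_eq_zero.1 hL.2).resolve_right (by rw [hxy]; linarith)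
    refine ⟨fun hne => ?_, fun h => ⟨by linarith, h2⟩⟩
    have hx : 0 < x := by
      by_contra hx
      have := mul_nonpos_of_nonpos_of_nonneg (not_lt.1 hx) hy
      linarith
    have hg : 0 < gU := lt_of_le_of_ne hU.1 fun h => hne (by rw [h2, ← h, sub_zero])
    refine ⟨by rw [hxy, abs_of_pos ht], ?_⟩
    rw [h2, sub_zero]
    positivity

/-! ### Fritz John conditions for NLP(t) -/

namespace CCProblem

variable {n m p : ℕ} {P : CCProblem n m p}

variable (P) in
/-- Fritz John multipliers of `NLP(t)`: the conditions of `IsKKTReg`, with a multiplier `α ≥ 0`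
for the objective. -/
structure FJMultReg (t : ℝ) (z : Euc n × Euc n) (α : ℝ) (lam : Fin m → ℝ) (mu : Fin p → ℝ)
    (nuL nuU : Fin n → ℝ) (del : ℝ) (gamL gamU : Fin n → ℝ) : Prop where
  obj : 0 ≤ α
  statX : P.statVec α (lam, mu, fun i => (gamU i - gamL i) * z.2 i) z.1 = 0
  statY : ∀ i, (gamU i - gamL i) * z.1 i + nuU i - nuL i - del = 0
  ineq : ∀ i, 0 ≤ lam i ∧ lam i * P.g i z.1 = 0
  lower : ∀ i, 0 ≤ nuL i ∧ nuL i * z.2 i = 0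
  upper : ∀ i, 0 ≤ nuU i ∧ nuU i * (z.2 i - 1) = 0
  card : 0 ≤ del ∧ del * ((n : ℝ) - (P.κ : ℝ) - ∑ i, z.2 i) = 0
  complU : ∀ i, 0 ≤ gamU i ∧ gamU i * (z.1 i * z.2 i - t) = 0
  complL : ∀ i, 0 ≤ gamL i ∧ gamL i * (-t - z.1 i * z.2 i) = 0

theorem isKKTReg_iff {t : ℝ} {z : Euc n × Euc n} : P.IsKKTReg t z ↔ z ∈ P.Zreg t ∧
    ∃ lam mu nuL nuU del gamL gamU, P.FJMultReg t z 1 lam mu nuL nuU del gamL gamU := by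
  refine and_congr_right fun _ => ⟨?_, ?_⟩
  · rintro ⟨lam, mu, nuL, nuU, del, gamL, gamU, h1, h2, h3, h4, h5, h6, h7, h8⟩
    exact ⟨lam, mu, nuL, nuU, del, gamL, gamU, zero_le_one, by simpa [statVec] using h1, h2, h3, h4,
      h5, h6, h7, h8⟩
  · rintro ⟨lam, mu, nuL, nuU, del, gamL, gamU, h⟩
    exact ⟨lam, mu, nuL, nuU, del, gamL, gamU, by simpa [statVec] using h.statX, h.statY, h.ineq,
      h.lower, h.upper, h.card, h.complU, h.complL⟩

namespace FJMultReg

variable {t : ℝ} {z : Euc n × Euc n} {α : ℝ} {lam : Fin m → ℝ} {mu : Fin p → ℝ}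
  {nuL nuU : Fin n → ℝ} {del : ℝ} {gamL gamU : Fin n → ℝ}

theorem smul (h : P.FJMultReg t z α lam mu nuL nuU del gamL gamU) {c : ℝ} (hc : 0 ≤ c) :
    P.FJMultReg t z (c * α) (c • lam) (c • mu) (c • nuL) (c • nuU) (c * del) (c • gamL)
      (c • gamU) where
  obj := mul_nonneg hc h.obj
  statX := by
    have h1 := congrArg (c • ·) h.statX
    simp only [smul_statVec, smul_zero] at h1
    rw [← h1]
    congr 1
    simp only [Prod.smul_mk, Prod.mk.injEq, true_and]
    funext i
    simp only [Pi.smul_apply, smul_eq_mul]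
    ring
  statY i := by
    have := congrArg (c * ·) (h.statY i)
    simp only [mul_zero] at this
    simp only [Pi.smul_apply, smul_eq_mul]
    rw [← this]; ring
  ineq i := ⟨mul_nonneg hc (h.ineq i).1, by
    simp only [Pi.smul_apply, smul_eq_mul, mul_assoc, (h.ineq i).2, mul_zero]⟩
  lower i := ⟨mul_nonneg hc (h.lower i).1, by
    simp only [Pi.smul_apply, smul_eq_mul, mul_assoc, (h.lower i).2, mul_zero]⟩
  upper i := ⟨mul_nonneg hc (h.upper i).1, by
    simp only [Pi.smul_apply, smul_eq_mul, mul_assoc, (h.upper i).2, mul_zero]⟩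
  card := ⟨mul_nonneg hc h.card.1, by simp only [mul_assoc, h.card.2, mul_zero]⟩
  complU i := ⟨mul_nonneg hc (h.complU i).1, by
    simp only [Pi.smul_apply, smul_eq_mul, mul_assoc, (h.complU i).2, mul_zero]⟩
  complL i := ⟨mul_nonneg hc (h.complL i).1, by
    simp only [Pi.smul_apply, smul_eq_mul, mul_assoc, (h.complL i).2, mul_zero]⟩

theorem isKKTReg (h : P.FJMultReg t z α lam mu nuL nuU del gamL gamU) (hz : z ∈ P.Zreg t)
    (hα : α ≠ 0) : P.IsKKTReg t z := by
  have := h.smul (inv_nonneg.2 h.obj)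
  rw [inv_mul_cancel₀ hα] at this
  exact isKKTReg_iff.2 ⟨hz, _, _, _, _, _, _, _, this⟩

theorem yMultSystem (h : P.FJMultReg t z α lam mu nuL nuU del gamL gamU) (ht : 0 < t)
    (hz : z ∈ P.Zreg t) :
    YMultSystem P.κ t z.1 z.2 (fun i => gamU i - gamL i) nuL nuU del :=
  ⟨h.statY, h.lower, h.upper, h.card, fun i =>
    (relaxed_compl ht (hz.2.2.1 i).1 (h.complU i) (h.complL i)).1⟩

/-- If `κ > 0`, Fritz John multipliers of `NLP(t)` that vanish on the objective and in the
derivative with respect to `x` vanish altogether. -/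
theorem eq_zero (h : P.FJMultReg t z α lam mu nuL nuU del gamL gamU) (ht : 0 < t)
    (hz : z ∈ P.Zreg t) (hκ : 0 < P.κ) (h0 : ∀ i, (gamU i - gamL i) * z.2 i = 0) :
    nuL = 0 ∧ nuU = 0 ∧ del = 0 ∧ gamL = 0 ∧ gamU = 0 := by
  have hg : ∀ i, gamU i - gamL i = 0 := by
    intro i
    by_contra hne
    have h1 := ((relaxed_compl ht (hz.2.2.1 i).1 (h.complU i) (h.complL i)).1 hne).1
    rw [(mul_eq_zero.1 (h0 i)).resolve_left hne, mul_zero, abs_zero] at h1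
    exact ht.ne h1
  have hgg := fun i => (relaxed_compl ht (hz.2.2.1 i).1 (h.complU i) (h.complL i)).2 (hg i)
  have hst : ∀ i, nuU i - nuL i = del := by
    intro i
    have := h.statY i
    rw [hg i] at this
    linarith
  -- If δ > 0, every upper bound multiplier is positive, so y = e; but the active cardinality
  -- constraint says ∑ y_i = n - κ < n.
  have hdel : del = 0 := by
    by_contra hne
    have hpos : 0 < del := lt_of_le_of_ne h.card.1 (Ne.symm hne)
    have hy : ∀ i, z.2 i = 1 := by
      intro i
      have hU : nuU i ≠ 0 := by
        intro hU
        linarith [hst i, (h.lower i).1]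
      linarith [(mul_eq_zero.1 (h.upper i).2).resolve_left hU]
    have h1 := (mul_eq_zero.1 h.card.2).resolve_left hne
    simp only [hy, Finset.sum_const, Finset.card_univ, Fintype.card_fin, nsmul_eq_mul,
      mul_one] at h1
    have : (0 : ℝ) < P.κ := by exact_mod_cast hκ
    linarith
  have hnu : ∀ i, nuL i = 0 := by
    intro i
    have e : nuU i = nuL i := by linarith [hst i]
    have h1 := (h.upper i).2
    have h2 := (h.lower i).2
    rw [e] at h1
    linarith
  refine ⟨funext hnu, funext fun i => ?_, hdel, funext fun i => (hgg i).2,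
    funext fun i => (hgg i).1⟩
  have := hst i
  rw [hnu i, hdel, sub_zero] at this
  exact this

end FJMultReg

/-- The general Fritz John conditions in (x, y) only give some nonzero multiplier; for κ > 0,
`FJMultReg.eq_zero` rules out that the nonzero ones all belong to constraints invisible in the
x-equation. -/
theorem exists_fjMultReg_of_card_pos (hP : P.Smooth 1) (hκ : 0 < P.κ) {t : ℝ} (ht : 0 < t)
    {z : Euc n × Euc n} (hz : P.IsLocalMinReg t z) :
    ∃ α lam mu nuL nuU del gamL gamU, P.FJMultReg t z α lam mu nuL nuU del gamL gamU ∧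
      (α, lam, mu, fun i => (gamU i - gamL i) * z.2 i) ≠ (0 : ℝ × Mult m p n) := by
  obtain ⟨hzf, hmin⟩ := hz
  let px : Fin n → Euc n × Euc n →L[ℝ] ℝ := fun i =>
    (EuclideanSpace.proj i).comp (ContinuousLinearMap.fst ℝ (Euc n) (Euc n))
  let py : Fin n → Euc n × Euc n →L[ℝ] ℝ := fun i =>
    (EuclideanSpace.proj i).comp (ContinuousLinearMap.snd ℝ (Euc n) (Euc n))
  -- The blocks are, in order: g, -y, y - e, the cardinality constraint, and the upper and lower
  -- bounds on x ∘ y.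
  let G : Fin m ⊕ Fin n ⊕ Fin n ⊕ Unit ⊕ Fin n ⊕ Fin n → Euc n × Euc n → ℝ :=
    Sum.elim (fun i w => P.g i w.1) <| Sum.elim (fun i w => -py i w) <|
      Sum.elim (fun i w => py i w - 1) <| Sum.elim (fun _ w => (n : ℝ) - P.κ - ∑ i, py i w) <|
      Sum.elim (fun i w => px i w * py i w - t) fun i w => -t - px i w * py i w
  let H : Fin p → Euc n × Euc n → ℝ := fun j w => P.h j w.1
  have hset : P.Zreg t = {w | (∀ i, G i w ≤ 0) ∧ ∀ j, H j w = 0} := by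
    ext w
    simp only [Zreg, Set.mem_ofPred_eq, Sum.forall, G, H, Sum.elim_inl, Sum.elim_inr, px, py,
      ContinuousLinearMap.comp_apply, ContinuousLinearMap.coe_fst', ContinuousLinearMap.coe_snd',
      PiLp.proj_apply, sub_nonpos, neg_nonpos, forall_const]
    constructor
    · rintro ⟨h1, h2, h3, h4, h5⟩
      exact ⟨⟨h1, fun i => (h3 i).1, fun i => (h3 i).2, h4, fun i => (h5 i).2,
        fun i => (h5 i).1⟩, h2⟩
    · rintro ⟨⟨h1, h3, h3', h4, h5, h5'⟩, h2⟩
      exact ⟨h1, h2, fun i => ⟨h3 i, h3' i⟩, h4, fun i => ⟨h5' i, h5 i⟩⟩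
  have hGc : ∀ i, ContDiff ℝ 1 (G i) := by
    have hpx : ∀ i, ContDiff ℝ 1 (px i) := fun i => (px i).contDiff
    have hpy : ∀ i, ContDiff ℝ 1 (py i) := fun i => (py i).contDiff
    rintro (i | i | i | i | i | i)
    · exact (hP.2.1 i).comp contDiff_fst
    · exact (hpy i).neg
    · exact (hpy i).sub contDiff_const
    · exact contDiff_const.sub (ContDiff.sum fun i _ => hpy i)
    · exact ((hpx i).mul (hpy i)).sub contDiff_const
    · exact contDiff_const.sub ((hpx i).mul (hpy i))
  have hfz : z ∈ {w | (∀ i, G i w ≤ 0) ∧ ∀ j, H j w = 0} := hset ▸ hzf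
  rw [hset] at hmin
  obtain ⟨α, lam, mu, hα, hlam, hne, hst⟩ := exists_fritzJohn_multipliers
    (f := fun w : Euc n × Euc n => P.f w.1) (h := H) (hP.1.comp contDiff_fst) hGc
    (fun j => (hP.2.2 j).comp contDiff_fst) hfz.1 hfz.2 hmin
  have dcomp : ∀ {φ : Euc n → ℝ}, ContDiff ℝ 1 φ → ∀ d : Euc n × Euc n,
      fderiv ℝ (fun w : Euc n × Euc n => φ w.1) z d = fderiv ℝ φ z.1 d.1 := by
    intro φ hφ d
    have : HasFDerivAt (fun w : Euc n × Euc n => φ w.1)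
        ((fderiv ℝ φ z.1).comp (ContinuousLinearMap.fst ℝ (Euc n) (Euc n))) z :=
      (hφ.differentiable one_ne_zero z.1).hasFDerivAt.comp z hasFDerivAt_fst
    rw [this.fderiv]; rfl
  have dneg : ∀ i d, fderiv ℝ (fun w => -py i w) z d = -d.2 i := by
    intro i d
    rw [((py i).hasFDerivAt.fun_neg).fderiv]; rfl
  have dup : ∀ i d, fderiv ℝ (fun w => py i w - 1) z d = d.2 i := by
    intro i d
    rw [((py i).hasFDerivAt.sub_const 1).fderiv]; rfl
  have dcard : ∀ d, fderiv ℝ (fun w => (n : ℝ) - P.κ - ∑ i, py i w) z d = -∑ i, d.2 i := by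
    intro d
    rw [((HasFDerivAt.fun_sum fun i _ => (py i).hasFDerivAt).const_sub ((n : ℝ) - P.κ)).fderiv]
    simp [py]
  have dU : ∀ i d, fderiv ℝ (fun w => px i w * py i w - t) z d
      = z.1 i * d.2 i + z.2 i * d.1 i := by
    intro i d
    rw [(((px i).hasFDerivAt.fun_mul (py i).hasFDerivAt).sub_const t).fderiv]; rfl
  have dL : ∀ i d, fderiv ℝ (fun w => -t - px i w * py i w) z d
      = -(z.1 i * d.2 i + z.2 i * d.1 i) := by
    intro i d
    rw [(((px i).hasFDerivAt.fun_mul (py i).hasFDerivAt).const_sub (-t)).fderiv]; rfl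
  have key : ∀ d : Euc n × Euc n, α * fderiv ℝ P.f z.1 d.1
      + (∑ i, lam (.inl i) * fderiv ℝ (P.g i) z.1 d.1
        + (∑ i, lam (.inr (.inl i)) * -d.2 i + (∑ i, lam (.inr (.inr (.inl i))) * d.2 i
        + (lam (.inr (.inr (.inr (.inl ())))) * -∑ i, d.2 i
        + (∑ i, lam (.inr (.inr (.inr (.inr (.inl i))))) * (z.1 i * d.2 i + z.2 i * d.1 i)
        + ∑ i, lam (.inr (.inr (.inr (.inr (.inr i)))))
            * -(z.1 i * d.2 i + z.2 i * d.1 i))))))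
      + ∑ j, mu j * fderiv ℝ (P.h j) z.1 d.1 = 0 := by
    intro d
    have h1 := congrArg (fun L => L d) hst
    simp only [_root_.add_apply, _root_.sum_apply,
      _root_.smul_apply, smul_eq_mul, Fintype.sum_sum_type, G, H, Sum.elim_inl,
      Sum.elim_inr, _root_.zero_apply, dneg, dup, dcard, dU, dL, dcomp hP.1,
      fun i => dcomp (hP.2.1 i), fun j => dcomp (hP.2.2 j), Finset.univ_unique,
      Finset.sum_singleton] at h1
    exact h1
  have hFJ : P.FJMultReg t z α (fun i => lam (.inl i)) mu (fun i => lam (.inr (.inl i)))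
      (fun i => lam (.inr (.inr (.inl i)))) (lam (.inr (.inr (.inr (.inl ())))))
      (fun i => lam (.inr (.inr (.inr (.inr (.inr i))))))
      (fun i => lam (.inr (.inr (.inr (.inr (.inl i)))))) := by
    refine ⟨hα, ?_, fun i => ?_, fun i => hlam (.inl i), fun i => ⟨(hlam _).1, ?_⟩,
      fun i => hlam (.inr (.inr (.inl i))), hlam (.inr (.inr (.inr (.inl ())))),
      fun i => hlam (.inr (.inr (.inr (.inr (.inl i))))),
      fun i => hlam (.inr (.inr (.inr (.inr (.inr i)))))⟩
    · refine ext_inner_right ℝ fun v => ?_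
      have h1 := key (v, 0)
      rw [inner_statVec, inner_zero_left, ← h1]
      simp only [PiLp.zero_apply, mul_zero, neg_zero, Finset.sum_const_zero, zero_add, sub_mul,
        Finset.sum_sub_distrib, mul_neg, Finset.sum_neg_distrib, mul_assoc]
      ring
    · have h1 := key (0, EuclideanSpace.single i 1)
      simp at h1
      linarith
    · have := (hlam (.inr (.inl i))).2
      have e : G (.inr (.inl i)) z = -z.2 i := rfl
      rw [e] at this
      linarith
  refine ⟨_, _, _, _, _, _, _, _, hFJ, fun h0 => hne ?_⟩
  simp only [Prod.mk_eq_zero] at h0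
  obtain ⟨h1, h2, h3, h4⟩ := h0
  obtain ⟨e1, e2, e3, e4, e5⟩ := hFJ.eq_zero ht hzf hκ fun i => congrFun h4 i
  have hlam0 : lam = 0 := by
    funext i
    rcases i with i | i | i | i | i | i
    · exact congrFun h2 i
    · exact congrFun e1 i
    · exact congrFun e2 i
    · exact e3
    · exact congrFun e5 i
    · exact congrFun e4 i
  rw [h1, hlam0, h3]; rfl

theorem exists_fjMultReg_of_card_eq_zero (hP : P.Smooth 1) (hκ : P.κ = 0) {t : ℝ} (ht : 0 < t)
    {z : Euc n × Euc n} (hz : P.IsLocalMinReg t z) :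
    ∃ α lam mu nuL nuU del gamL gamU, P.FJMultReg t z α lam mu nuL nuU del gamL gamU ∧
      (α, lam, mu, fun i => (gamU i - gamL i) * z.2 i) ≠ (0 : ℝ × Mult m p n) := by
  obtain ⟨hzf, hmin⟩ := hz
  have hsum : ∑ i, z.2 i = n := by
    refine le_antisymm ?_ (by simpa [hκ] using hzf.2.2.2.1)
    simpa using Finset.sum_le_sum fun i (_ : i ∈ Finset.univ) => (hzf.2.2.1 i).2
  have hy : ∀ i, z.2 i = 1 := by
    have h1 : ∑ i, (1 - z.2 i) = 0 := by simp [hsum]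
    rw [Finset.sum_eq_zero_iff_of_nonneg fun i _ => by linarith [(hzf.2.2.1 i).2]] at h1
    intro i
    linarith [h1 i (Finset.mem_univ i)]
  let px : Fin n → Euc n →L[ℝ] ℝ := fun i => EuclideanSpace.proj i
  let G : Fin m ⊕ Fin n ⊕ Fin n → Euc n → ℝ :=
    Sum.elim P.g <| Sum.elim (fun i w => px i w - t) fun i w => -t - px i w
  have hset : ∀ x : Euc n, (x, z.2) ∈ P.Zreg t ↔ (∀ i, G i x ≤ 0) ∧ ∀ j, P.h j x = 0 := by
    intro x
    simp only [Zreg, Set.mem_ofPred_eq, Sum.forall, G, Sum.elim_inl, Sum.elim_inr, px,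
      PiLp.proj_apply, sub_nonpos, hy, mul_one]
    constructor
    · rintro ⟨h1, h2, h3, h4, h5⟩
      exact ⟨⟨h1, fun i => (h5 i).2, fun i => (h5 i).1⟩, h2⟩
    · rintro ⟨⟨h1, h5, h5'⟩, h2⟩
      exact ⟨h1, h2, by simp, by simp, fun i => ⟨h5' i, h5 i⟩⟩
  have hGc : ∀ i, ContDiff ℝ 1 (G i) := by
    have hpx : ∀ i, ContDiff ℝ 1 (px i) := fun i => (px i).contDiff
    rintro (i | i | i)
    · exact hP.2.1 i
    · exact (hpx i).sub contDiff_const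
    · exact contDiff_const.sub (hpx i)
  have hfz := (hset z.1).1 hzf
  have hmin' : IsLocalMinOn P.f {x | (∀ i, G i x ≤ 0) ∧ ∀ j, P.h j x = 0} z.1 := by
    have hc : Tendsto (fun x : Euc n => (x, z.2)) (𝓝[{x | (∀ i, G i x ≤ 0) ∧ ∀ j, P.h j x = 0}] z.1)
        (𝓝[P.Zreg t] z) :=
      tendsto_nhdsWithin_iff.2 ⟨((Continuous.prodMk_left z.2).tendsto z.1).mono_left
        nhdsWithin_le_nhds, eventually_nhdsWithin_of_forall fun x hx => (hset x).2 hx⟩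
    exact hc.eventually hmin
  obtain ⟨α, lam, mu, hα, hlam, hne, hst⟩ := exists_fritzJohn_multipliers
    hP.1 hGc hP.2.2 hfz.1 hfz.2 hmin'
  have dU : ∀ i d, fderiv ℝ (fun w => px i w - t) z.1 d = d i := by
    intro i d
    rw [((px i).hasFDerivAt.sub_const t).fderiv]; rfl
  have dL : ∀ i d, fderiv ℝ (fun w => -t - px i w) z.1 d = -d i := by
    intro i d
    rw [((px i).hasFDerivAt.const_sub (-t)).fderiv]; rfl
  set gU : Fin n → ℝ := fun i => lam (.inr (.inl i)) with hgU
  set gL : Fin n → ℝ := fun i => lam (.inr (.inr i)) with hgL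
  -- All constraints y ≤ e and the cardinality constraint are active, so δ may be any number at
  -- least as large as every γ_i x_i; the sum of absolute values is one, and the upper bound
  -- multipliers are the slacks δ - γ_i x_i.
  have hFJ : P.FJMultReg t z α (fun i => lam (.inl i)) mu 0
      (fun i => (∑ l, |(gU l - gL l) * z.1 l|) - (gU i - gL i) * z.1 i)
      (∑ l, |(gU l - gL l) * z.1 l|) gL gU := by
    refine ⟨hα, ?_, fun i => by simp, fun i => hlam (.inl i), fun i => by simp,
      fun i => ⟨?_, by simp [hy]⟩, ⟨by positivity, by simp [hκ, hsum]⟩, fun i => ?_, fun i => ?_⟩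
    · refine ext_inner_right ℝ fun v => ?_
      have h1 := congrArg (fun L => L v) hst
      simp only [_root_.add_apply, _root_.sum_apply,
        _root_.smul_apply, smul_eq_mul, Fintype.sum_sum_type, G, Sum.elim_inl,
        Sum.elim_inr, _root_.zero_apply, dU, dL] at h1
      rw [inner_statVec, inner_zero_left, ← h1]
      simp only [hy, hgU, hgL, mul_one, sub_mul, Finset.sum_sub_distrib, mul_neg,
        Finset.sum_neg_distrib]
      ring
    · have h1 := Finset.single_le_sum (f := fun l => |(gU l - gL l) * z.1 l|)
        (fun _ _ => abs_nonneg _) (Finset.mem_univ i)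
      have h2 := le_abs_self ((gU i - gL i) * z.1 i)
      simp only at h1
      linarith
    · rw [hy, mul_one]; exact hlam (.inr (.inl i))
    · rw [hy, mul_one]; exact hlam (.inr (.inr i))
  refine ⟨_, _, _, _, _, _, _, _, hFJ, fun h0 => hne ?_⟩
  simp only [Prod.mk_eq_zero] at h0
  obtain ⟨h1, h2, h3, h4⟩ := h0
  have h5 : ∀ i, gU i = 0 ∧ gL i = 0 := fun i =>
    (relaxed_compl ht (hzf.2.2.1 i).1 (hFJ.complU i) (hFJ.complL i)).2
      (by simpa [hy] using congrFun h4 i)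
  have hlam0 : lam = 0 := by
    funext i
    rcases i with i | i | i
    · exact congrFun h2 i
    · exact (h5 i).1
    · exact (h5 i).2
  rw [h1, hlam0, h3]; rfl

/-- Fritz John conditions for `NLP(t)`; the linear constraints on `y` may be left out of the
nontriviality condition. -/
theorem IsLocalMinReg.exists_fjMultReg (hP : P.Smooth 1) {t : ℝ} (ht : 0 < t)
    {z : Euc n × Euc n} (hz : P.IsLocalMinReg t z) :
    ∃ α lam mu nuL nuU del gamL gamU, P.FJMultReg t z α lam mu nuL nuU del gamL gamU ∧
      (α, lam, mu, fun i => (gamU i - gamL i) * z.2 i) ≠ (0 : ℝ × Mult m p n) := by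
  rcases Nat.eq_zero_or_pos P.κ with hκ | hκ
  · exact exists_fjMultReg_of_card_eq_zero hP hκ ht hz
  · exact exists_fjMultReg_of_card_pos hP hκ ht hz

/-! ### Feasible sets: limits, projection to x, compactness -/

theorem tendsto_coord {n : ℕ} {u : ℕ → Euc n} {x : Euc n} (hu : Tendsto u atTop (𝓝 x))
    (i : Fin n) : Tendsto (fun k => u k i) atTop (𝓝 (x i)) :=
  ((PiLp.continuous_apply 2 _ i).tendsto x).comp hu

/-- Limits of feasible points of `NLP(t_k)` with `t_k → 0` are feasible for the reformulation. -/
theorem mem_Z_of_tendsto (hP : P.Smooth 1) {t : ℕ → ℝ} (ht : Tendsto t atTop (𝓝 0))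
    {z : ℕ → Euc n × Euc n} (hz : ∀ k, z k ∈ P.Zreg (t k)) {zb : Euc n × Euc n}
    (hlim : Tendsto z atTop (𝓝 zb)) : zb ∈ P.Z := by
  have h1 : Tendsto (fun k => (z k).1) atTop (𝓝 zb.1) := (continuous_fst.tendsto zb).comp hlim
  have h2 : Tendsto (fun k => (z k).2) atTop (𝓝 zb.2) := (continuous_snd.tendsto zb).comp hlim
  refine ⟨fun i => le_of_tendsto' (((hP.2.1 i).continuous.tendsto _).comp h1) fun k => (hz k).1 i,
    fun j => tendsto_nhds_unique (((hP.2.2 j).continuous.tendsto _).comp h1)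
      (tendsto_const_nhds.congr fun k => ((hz k).2.1 j).symm),
    fun i => ⟨ge_of_tendsto' (tendsto_coord h2 i) fun k => ((hz k).2.2.1 i).1,
      le_of_tendsto' (tendsto_coord h2 i) fun k => ((hz k).2.2.1 i).2⟩,
    ge_of_tendsto' (tendsto_finsetSum _ fun i _ => tendsto_coord h2 i) fun k => (hz k).2.2.2.1,
    fun i => ?_⟩
  have h3 := (tendsto_coord h1 i).mul (tendsto_coord h2 i)
  exact le_antisymm (le_of_tendsto_of_tendsto' h3 ht fun k => ((hz k).2.2.2.2 i).2)
    (le_of_tendsto_of_tendsto' (by simpa using ht.neg) h3 fun k => ((hz k).2.2.2.2 i).1)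

theorem Z_subset_Zreg {t : ℝ} (ht : 0 ≤ t) : P.Z ⊆ P.Zreg t := fun z hz =>
  ⟨hz.1, hz.2.1, hz.2.2.1, hz.2.2.2.1, fun i => by rw [hz.2.2.2.2 i]; exact ⟨by linarith, ht⟩⟩

theorem zeroNorm_le_of_mem_Z {z : Euc n × Euc n} (hz : z ∈ P.Z) : zeroNorm z.1 ≤ P.κ := by
  obtain ⟨-, -, h3, h4, h5⟩ := hz
  have h : ∑ i, z.2 i ≤ ∑ i, (1 - if z.1 i ≠ 0 then (1 : ℝ) else 0) := by
    refine Finset.sum_le_sum fun i _ => ?_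
    by_cases hi : z.1 i = 0
    · simpa [hi] using (h3 i).2
    · simp [hi, (mul_eq_zero.1 (h5 i)).resolve_left hi]
  rw [Finset.sum_sub_distrib, Finset.sum_boole] at h
  simp only [Finset.sum_const, Finset.card_univ, Fintype.card_fin, nsmul_eq_mul, mul_one] at h
  have : ((Finset.univ.filter fun i => z.1 i ≠ 0).card : ℝ) ≤ P.κ := by linarith
  exact Nat.cast_le.1 this

theorem fst_mem_ccFeasible {z : Euc n × Euc n} (hz : z ∈ P.Z) : z.1 ∈ P.ccFeasible :=
  ⟨hz.1, hz.2.1, zeroNorm_le_of_mem_Z hz⟩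

theorem exists_mem_Z {x : Euc n} (hx : x ∈ P.ccFeasible) : ∃ y, (x, y) ∈ P.Z := by
  refine ⟨WithLp.toLp 2 fun i => 1 - if x i ≠ 0 then (1 : ℝ) else 0, hx.1, hx.2.1, fun i => ?_, ?_,
    fun i => ?_⟩
  · by_cases hi : x i = 0 <;> simp [hi]
  · have h : ((Finset.univ.filter fun i => x i ≠ 0).card : ℝ) ≤ P.κ := Nat.cast_le.2 hx.2.2
    simp only [Finset.sum_sub_distrib, Finset.sum_boole]
    simp only [Finset.sum_const, Finset.card_univ, Fintype.card_fin, nsmul_eq_mul, mul_one]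
    linarith
  · by_cases hi : x i = 0 <;> simp [hi]

theorem isCompact_unitBox : IsCompact {y : Euc n | ∀ i, 0 ≤ y i ∧ y i ≤ 1} := by
  refine Metric.isCompact_of_isClosed_isBounded ?_ ?_
  · simp only [Set.ofPred_forall]
    refine isClosed_iInter fun i => ?_
    exact (isClosed_le continuous_const (PiLp.continuous_apply 2 _ i)).inter
      (isClosed_le (PiLp.continuous_apply 2 _ i) continuous_const)
  · refine (Metric.isBounded_closedBall (x := (0 : Euc n)) (r := √n)).subset fun y hy => ?_
    rw [mem_closedBall_zero_iff, EuclideanSpace.norm_eq]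
    refine Real.sqrt_le_sqrt ?_
    calc ∑ i, ‖y i‖ ^ 2 ≤ ∑ _i : Fin n, (1 : ℝ) := Finset.sum_le_sum fun i _ => by
          rw [Real.norm_eq_abs, abs_of_nonneg (hy i).1]
          exact pow_le_one₀ (hy i).1 (hy i).2
      _ = n := by simp

theorem isClosed_Zreg (hP : P.Smooth 1) (t : ℝ) : IsClosed (P.Zreg t) := by
  have hx : ∀ i, Continuous fun z : Euc n × Euc n => z.1 i := fun i =>
    (PiLp.continuous_apply 2 _ i).comp continuous_fst
  have hy : ∀ i, Continuous fun z : Euc n × Euc n => z.2 i := fun i =>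
    (PiLp.continuous_apply 2 _ i).comp continuous_snd
  refine IsClosed.inter ?_ (IsClosed.inter ?_ (IsClosed.inter ?_ (IsClosed.inter ?_ ?_)))
  · exact isClosed_le (continuous_pi fun i => (hP.2.1 i).continuous.comp continuous_fst)
      continuous_const
  · change IsClosed {z : Euc n × Euc n | ∀ i, P.h i z.1 = 0}
    simp only [Set.ofPred_forall]
    exact isClosed_iInter fun i =>
      isClosed_eq ((hP.2.2 i).continuous.comp continuous_fst) continuous_const
  · change IsClosed {z : Euc n × Euc n | ∀ i, 0 ≤ z.2 i ∧ z.2 i ≤ 1}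
    simp only [Set.ofPred_forall]
    exact isClosed_iInter fun i => (isClosed_le continuous_const (hy i)).inter
      (isClosed_le (hy i) continuous_const)
  · exact isClosed_le continuous_const (continuous_finsetSum _ fun i _ => hy i)
  · change IsClosed {z : Euc n × Euc n | ∀ i, -t ≤ z.1 i * z.2 i ∧ z.1 i * z.2 i ≤ t}
    simp only [Set.ofPred_forall]
    exact isClosed_iInter fun i => (isClosed_le continuous_const ((hx i).mul (hy i))).inter
      (isClosed_le ((hx i).mul (hy i)) continuous_const)

/-! ### Limits of multipliers; parts (a) and (b) -/

/-- Normalised multipliers at a sequence of stationary points have a limit. -/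
theorem NoAbnormalMult.exists_subseq_tendsto (hP : P.Smooth 1) {xb : Euc n}
    (hreg : P.NoAbnormalMult xb) {x : ℕ → Euc n} (hx : Tendsto x atTop (𝓝 xb))
    {w : ℕ → Mult m p n} (hw : ∀ k i, 0 ≤ (w k).1 i ∧ (w k).1 i * P.g i (x k) = 0)
    (hdom : ∀ j, xb j ≠ 0 → ∀ ε > 0, ∀ᶠ k in atTop, |(w k).2.2 j| ≤ ε * ‖w k‖)
    (hstat : ∀ k, P.statVec 1 (w k) (x k) = 0) :
    ∃ (v : Mult m p n) (ψ : ℕ → ℕ), StrictMono ψ ∧ Tendsto (w ∘ ψ) atTop (𝓝 v) ∧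
      P.statVec 1 v xb = 0 ∧ (∀ i, 0 ≤ v.1 i ∧ v.1 i * P.g i xb = 0) ∧
      ∀ j, (∀ ε > 0, ∀ᶠ k in atTop, |(w k).2.2 j| ≤ ε * ‖w k‖) → v.2.2 j = 0 := by
  obtain ⟨C, hC⟩ := hreg.exists_norm_le hP hx (α := fun _ => 1) (fun _ => zero_le_one) hw hdom hstat
  obtain ⟨v, -, ψ, hψ, hlim⟩ := tendsto_subseq_of_frequently_bounded
    (Metric.isBounded_closedBall (x := (0 : Mult m p n)) (r := C * 1))
    (hC.mono fun k hk => mem_closedBall_zero_iff.2 hk).frequently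
  have hxs : Tendsto (x ∘ ψ) atTop (𝓝 xb) := hx.comp hψ.tendsto_atTop
  have hv1 : ∀ i, Tendsto (fun k => (w (ψ k)).1 i) atTop (𝓝 (v.1 i)) :=
    fun i => (((continuous_apply i).comp continuous_fst).tendsto v).comp hlim
  have hv3 : ∀ i, Tendsto (fun k => (w (ψ k)).2.2 i) atTop (𝓝 (v.2.2 i)) :=
    fun i => (((continuous_apply i).comp (continuous_snd.comp continuous_snd)).tendsto v).comp hlim
  refine ⟨v, ψ, hψ, hlim, ?_, fun i => ⟨ge_of_tendsto' (hv1 i) fun k => (hw _ _).1, ?_⟩,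
    fun j hj => ?_⟩
  · have h1 := ((continuous_statVec hP).tendsto (1, v, xb)).comp
      (tendsto_const_nhds.prodMk_nhds (hlim.prodMk_nhds hxs))
    exact tendsto_nhds_unique h1 (tendsto_const_nhds.congr fun k => (hstat (ψ k)).symm)
  · exact tendsto_nhds_unique ((hv1 i).mul (((hP.2.1 i).continuous.tendsto xb).comp hxs))
      (tendsto_const_nhds.congr fun k => (hw _ i).2.symm)
  · rw [← abs_eq_zero]
    have hle : ∀ ε > 0, |v.2.2 j| ≤ ε * ‖v‖ := fun ε hε =>
      le_of_tendsto_of_tendsto (hv3 j).abs (hlim.norm.const_mul ε)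
        (hψ.tendsto_atTop.eventually (hj ε hε))
    have h0 : Tendsto (fun ε : ℝ => ε * ‖v‖) (𝓝[>] 0) (𝓝 0) := by
      have : Tendsto (fun ε : ℝ => ε * ‖v‖) (𝓝 0) (𝓝 (0 * ‖v‖)) :=
        (continuous_id.mul continuous_const).tendsto 0
      rw [zero_mul] at this
      exact this.mono_left nhdsWithin_le_nhds
    exact le_antisymm (ge_of_tendsto h0 (eventually_nhdsWithin_of_forall hle)) (abs_nonneg _)

theorem FJMultReg.eventually_abs_le {t : ℕ → ℝ} (ht : ∀ k, 0 < t k)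
    {z : ℕ → Euc n × Euc n} {α : ℕ → ℝ} {lam : ℕ → Fin m → ℝ} {mu : ℕ → Fin p → ℝ}
    {nuL nuU : ℕ → Fin n → ℝ} {del : ℕ → ℝ} {gamL gamU : ℕ → Fin n → ℝ}
    (hz : ∀ k, z k ∈ P.Zreg (t k))
    (h : ∀ k, P.FJMultReg (t k) (z k) (α k) (lam k) (mu k) (nuL k) (nuU k) (del k) (gamL k)
      (gamU k)) {zb : Euc n × Euc n} (hlim : Tendsto z atTop (𝓝 zb)) (hzb : zb ∈ P.Z)
    {j : Fin n} (hj : zb.2 j = 0) {ε : ℝ} (hε : 0 < ε) :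
    ∀ᶠ k in atTop, |(gamU k j - gamL k j) * (z k).2 j| ≤
      ε * ‖((lam k, mu k, fun i => (gamU k i - gamL k i) * (z k).2 i) : Mult m p n)‖ := by
  have h1 := YMultSystem.eventually_abs_le ht (fun k => (h k).yMultSystem (ht k) (hz k))
    (fun k => (hz k).2.2.1) ((continuous_snd.tendsto zb).comp hlim) hzb.2.2.2.1 hj hε
  filter_upwards [h1] with k hk
  refine hk.trans (mul_le_mul_of_nonneg_left ?_ hε.le)
  exact (norm_snd_le (mu k, fun i => (gamU k i - gamL k i) * (z k).2 i)).trans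
    (norm_snd_le ((lam k, mu k, fun i => (gamU k i - gamL k i) * (z k).2 i) : Mult m p n))

/-- Limits of KKT points of `NLP(t_k)` with `t_k ↓ 0` are S-stationary. -/
theorem isSStationary_of_tendsto (hP : P.Smooth 1) {t : ℕ → ℝ} (ht : ∀ k, 0 < t k)
    (ht0 : Tendsto t atTop (𝓝 0)) {z : ℕ → Euc n × Euc n} (hz : ∀ k, P.IsKKTReg (t k) (z k))
    {zb : Euc n × Euc n} (hlim : Tendsto z atTop (𝓝 zb)) (hreg : P.NoAbnormalMult zb.1) :
    P.IsSStationary zb := by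
  have hzZ := fun k => (hz k).1
  have hzb := mem_Z_of_tendsto hP ht0 hzZ hlim
  choose lam mu nuL nuU del gamL gamU h using fun k => (isKKTReg_iff.1 (hz k)).2
  have hdom : ∀ j, zb.2 j = 0 → ∀ ε > 0, ∀ᶠ k in atTop,
      |(gamU k j - gamL k j) * (z k).2 j| ≤
        ε * ‖((lam k, mu k, fun i => (gamU k i - gamL k i) * (z k).2 i) : Mult m p n)‖ := fun j hj ε hε =>
    FJMultReg.eventually_abs_le ht hzZ h hlim hzb hj hε
  have hy0 : ∀ j, zb.1 j ≠ 0 → zb.2 j = 0 := fun j hj =>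
    (mul_eq_zero.1 (hzb.2.2.2.2 j)).resolve_left hj
  obtain ⟨v, ψ, -, -, hst, hsign, h0⟩ := hreg.exists_subseq_tendsto hP
    ((continuous_fst.tendsto zb).comp hlim)
    (w := fun k => (lam k, mu k, fun i => (gamU k i - gamL k i) * (z k).2 i))
    (fun k i => (h k).ineq i) (fun j hj => hdom j (hy0 j hj)) (fun k => (h k).statX)
  refine ⟨hzb, v.1, v.2.1, v.2.2, ⟨by simpa [statVec] using hst, hsign, fun i hi => ?_⟩,
    fun i hi => ?_⟩
  · exact h0 i (hdom i (Finset.mem_filter.1 hi).2.2)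
  · exact h0 i (hdom i (Finset.mem_filter.1 hi).2.2)

/-- Only x needs confining, as y lies in the unit box. The predicate K allows the subsequence to be
drawn from the bad indices in arguments by contradiction. -/
theorem exists_subseq_of_mem_closedBall {K : ℕ → Prop} (hK : ∃ᶠ k in atTop, K k)
    {z : ℕ → Euc n × Euc n} {x : Euc n} {r : ℝ}
    (h1 : ∀ k, K k → (z k).1 ∈ Metric.closedBall x r)
    (h2 : ∀ k, K k → ∀ i, 0 ≤ (z k).2 i ∧ (z k).2 i ≤ 1) :
    ∃ (zb : Euc n × Euc n) (ψ : ℕ → ℕ), zb.1 ∈ Metric.closedBall x r ∧ StrictMono ψ ∧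
      (∀ k, K (ψ k)) ∧ Tendsto (z ∘ ψ) atTop (𝓝 zb) := by
  obtain ⟨χ, hχ, hKχ⟩ := extraction_of_frequently_atTop hK
  obtain ⟨zb, hzb, ψ, hψ, hlim⟩ := ((isCompact_closedBall x r).prod
    (isCompact_unitBox (n := n))).tendsto_subseq (x := z ∘ χ)
    fun k => ⟨h1 _ (hKχ k), h2 _ (hKχ k)⟩
  exact ⟨zb, χ ∘ ψ, hzb.1, hχ.comp hψ, fun k => hKχ _, hlim⟩

theorem convergence_of_kkt (hP : P.Smooth 1) {xs : Euc n} (hreg : P.CCMFCQ xs) :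
    ∃ r₀ > 0, ∀ r ≤ r₀, ∀ t : ℕ → ℝ, (∀ k, 0 < t k) → Tendsto t atTop (𝓝 0) →
      ∀ z : ℕ → Euc n × Euc n,
        (∀ k, P.IsKKTReg (t k) (z k) ∧ (z k).1 ∈ Metric.ball xs r) →
          (∃ zb, MapClusterPt zb atTop z) ∧
          ∀ zb, MapClusterPt zb atTop z → P.IsSStationary zb := by
  -- CC-MFCQ has to hold at the limit points, which may differ from `xs` and may reach the boundary
  -- of the ball.
  obtain ⟨r₀, hr₀, hball⟩ := Metric.nhds_basis_closedBall.eventually_iff.1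
    (hreg.noAbnormalMult.eventually hP)
  refine ⟨r₀, hr₀, fun r hr t ht ht0 z hz => ⟨?_, fun zb hzb => ?_⟩⟩
  · obtain ⟨zb, ψ, -, hψ, -, hlim⟩ := exists_subseq_of_mem_closedBall (K := fun _ => True)
      (Eventually.of_forall fun _ => trivial).frequently
      (fun k _ => Metric.ball_subset_closedBall (hz k).2) (fun k _ => (hz k).1.1.2.2.1)
    exact ⟨zb, hlim.mapClusterPt.of_comp hψ.tendsto_atTop⟩
  · obtain ⟨ψ, hψ, hlim⟩ := hzb.tendsto_subseq
    refine isSStationary_of_tendsto hP (t := t ∘ ψ) (fun k => ht _) (ht0.comp hψ.tendsto_atTop)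
      (fun k => (hz (ψ k)).1) hlim (hball ?_)
    exact Metric.isClosed_closedBall.mem_of_tendsto ((continuous_fst.tendsto zb).comp hlim)
      (Eventually.of_forall fun k => Metric.closedBall_subset_closedBall hr
        (Metric.ball_subset_closedBall (hz (ψ k)).2))

/-- Near a point satisfying CC-MFCQ, local minima of `NLP(t_k)` are eventually KKT points. -/
theorem exists_isKKTReg_of_tendsto (hP : P.Smooth 1) {t : ℕ → ℝ} (ht : ∀ k, 0 < t k)
    (ht0 : Tendsto t atTop (𝓝 0)) {z : ℕ → Euc n × Euc n}
    (hz : ∀ k, P.IsLocalMinReg (t k) (z k)) {zb : Euc n × Euc n}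
    (hlim : Tendsto z atTop (𝓝 zb)) (hreg : P.NoAbnormalMult zb.1) :
    ∃ k, P.IsKKTReg (t k) (z k) := by
  by_contra hcon
  push Not at hcon
  have hzZ := fun k => (hz k).1
  have hzb := mem_Z_of_tendsto hP ht0 hzZ hlim
  choose α lam mu nuL nuU del gamL gamU h hne using fun k => (hz k).exists_fjMultReg hP (ht k)
  have hα : ∀ k, α k = 0 := fun k => by
    by_contra h0
    exact hcon k ((h k).isKKTReg (hzZ k) h0)
  obtain ⟨C, hC⟩ := hreg.exists_norm_le hP ((continuous_fst.tendsto zb).comp hlim)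
    (fun k => (h k).obj)
    (w := fun k => (lam k, mu k, fun i => (gamU k i - gamL k i) * (z k).2 i))
    (fun k i => (h k).ineq i)
    (fun j hj ε hε => FJMultReg.eventually_abs_le ht hzZ h hlim hzb
      ((mul_eq_zero.1 (hzb.2.2.2.2 j)).resolve_left hj) hε) (fun k => (h k).statX)
  obtain ⟨k, hk⟩ := hC.exists
  apply hne k
  rw [hα, mul_zero] at hk
  exact Prod.ext (hα k) (norm_le_zero_iff.1 hk)

/-- Existence of local minima of `NLP(t)` that are KKT points, arbitrarily close to a strict local
minimizer of the cardinality constrained problem. -/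
theorem IsStrictLocalMinCC.exists_isKKTReg (hP : P.Smooth 1) {xs : Euc n}
    (hxs : P.IsStrictLocalMinCC xs) (hreg : P.CCMFCQ xs) {r : ℝ} (hr : 0 < r) :
    ∃ T > 0, ∀ t : ℝ, 0 < t → t ≤ T →
      ∃ z : Euc n × Euc n, P.IsLocalMinReg t z ∧ P.IsKKTReg t z ∧ z.1 ∈ Metric.ball xs r := by
  by_contra hcon
  push Not at hcon
  obtain ⟨hfeas, r₁, hr₁, hstrict⟩ := hxs
  choose t ht htk hno using fun k : ℕ => hcon (1 / ((k : ℝ) + 1)) (by positivity)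
  have ht0 : Tendsto t atTop (𝓝 0) :=
    squeeze_zero (fun k => (ht k).le) htk tendsto_one_div_add_atTop_nhds_zero_nat
  obtain ⟨ys, hys⟩ := exists_mem_Z hfeas
  set ρ := min r (r₁ / 2) with hρ
  -- Halving r₁ keeps the closed ball of radius ρ inside the open ball of strict minimality.
  have hρ0 : 0 < ρ := lt_min hr (by linarith)
  have hρ1 : ρ < r₁ := (min_le_right _ _).trans_lt (by linarith)
  set B : Set (Euc n × Euc n) := Metric.closedBall xs ρ ×ˢ {y | ∀ i, 0 ≤ y i ∧ y i ≤ 1} with hB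
  have hBc : IsCompact B := (isCompact_closedBall xs ρ).prod isCompact_unitBox
  have hmem : ∀ k, (xs, ys) ∈ B ∩ P.Zreg (t k) := fun k =>
    ⟨⟨Metric.mem_closedBall_self hρ0.le, hys.2.2.1⟩, Z_subset_Zreg (ht k).le hys⟩
  choose z hzB hzmin using fun k => (hBc.inter_right (isClosed_Zreg hP (t k))).exists_isMinOn
    ⟨_, hmem k⟩ (f := fun w => P.f w.1) (hP.1.continuous.comp continuous_fst).continuousOn
  have hsub : ∃ (zb : Euc n × Euc n) (ψ : ℕ → ℕ), zb.1 ∈ Metric.closedBall xs ρ ∧ StrictMono ψ ∧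
      (∀ k, True) ∧ Tendsto (z ∘ ψ) atTop (𝓝 zb) :=
    exists_subseq_of_mem_closedBall (K := fun _ => True)
      (Eventually.of_forall fun _ => trivial).frequently
      (fun k _ => (hzB k).1.1) (fun k _ => (hzB k).1.2)
  obtain ⟨zb, ψ, hzbB, hψ, -, hlim⟩ := hsub
  have htψ := ht0.comp hψ.tendsto_atTop
  have hlim1 : Tendsto (fun k => (z (ψ k)).1) atTop (𝓝 zb.1) :=
    (continuous_fst.tendsto zb).comp hlim
  have hzb : zb ∈ P.Z := mem_Z_of_tendsto hP htψ (fun k => (hzB (ψ k)).2) hlim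
  have hfle : P.f zb.1 ≤ P.f xs := le_of_tendsto' ((hP.1.continuous.tendsto _).comp hlim1)
    fun k => hzmin (ψ k) (hmem (ψ k))
  have hx : zb.1 = xs := by
    by_contra hne
    exact absurd (hstrict zb.1 (Metric.closedBall_subset_ball hρ1 hzbB) (fst_mem_ccFeasible hzb) hne)
      (not_lt.2 hfle)
  have hin : ∀ᶠ k in atTop, (z (ψ k)).1 ∈ Metric.ball xs ρ := by
    rw [hx] at hlim1
    exact hlim1.eventually (Metric.ball_mem_nhds xs hρ0)
  obtain ⟨N, hN⟩ := eventually_atTop.1 hin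
  -- Once x is interior to the ball, the ball no longer restricts nearby competitors, and the box is
  -- already implied by feasibility.
  have hloc : ∀ k, P.IsLocalMinReg (t (ψ (k + N))) (z (ψ (k + N))) := fun k => by
    refine ⟨(hzB _).2, ?_⟩
    refine eventually_nhdsWithin_iff.2 ?_
    have hopen : ∀ᶠ w in 𝓝 (z (ψ (k + N))), w.1 ∈ Metric.ball xs ρ :=
      continuous_fst.continuousAt.eventually
        (Metric.isOpen_ball.mem_nhds (hN (k + N) (Nat.le_add_left _ _)))
    filter_upwards [hopen] with w hw hwZ
    exact hzmin _ ⟨⟨Metric.ball_subset_closedBall hw, hwZ.2.2.1⟩, hwZ⟩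
  have hsh : Tendsto (fun k : ℕ => k + N) atTop atTop := tendsto_add_atTop_nat N
  obtain ⟨k, hk⟩ := exists_isKKTReg_of_tendsto hP (fun k => ht (ψ (k + N))) (htψ.comp hsh) hloc
    (hlim.comp hsh) (hx ▸ hreg.noAbnormalMult)
  exact hno _ _ (hloc k) hk (Metric.ball_subset_ball (min_le_left _ _)
    (hN (k + N) (Nat.le_add_left _ _)))

/-! ### The case ‖x‖₀ = κ -/

/-- `y` is determined by `x` when `‖x‖₀ = κ`. -/
theorem snd_eq_of_mem_Z {x y : Euc n} (hz : (x, y) ∈ P.Z) (hx : zeroNorm x = P.κ) (i : Fin n) :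
    y i = 1 - if x i ≠ 0 then (1 : ℝ) else 0 := by
  have hle : ∀ i, y i ≤ 1 - if x i ≠ 0 then (1 : ℝ) else 0 := by
    intro i
    by_cases hi : x i = 0
    · simpa [hi] using (hz.2.2.1 i).2
    · have h0 : y i = 0 := (mul_eq_zero.1 (hz.2.2.2.2 i)).resolve_left hi
      simp [hi, h0]
  have hsum : ∑ i, (1 - (if x i ≠ 0 then (1 : ℝ) else 0)) = n - P.κ := by
    rw [Finset.sum_sub_distrib, Finset.sum_boole, ← hx]
    simp [zeroNorm]
  have h0 : ∑ i, ((1 - if x i ≠ 0 then (1 : ℝ) else 0) - y i) = 0 := by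
    refine le_antisymm ?_ (Finset.sum_nonneg fun i _ => sub_nonneg.2 (hle i))
    rw [Finset.sum_sub_distrib, hsum]
    have := hz.2.2.2.1
    simp only at this
    linarith
  rw [Finset.sum_eq_zero_iff_of_nonneg fun i _ => sub_nonneg.2 (hle i)] at h0
  linarith [h0 i (Finset.mem_univ i)]

/-- A strict local minimum of the reformulation with `‖x‖₀ = κ` is a strict local minimizer of the
cardinality constrained problem. -/
theorem IsStrictLocalMinWrtX.isStrictLocalMinCC {xs ys : Euc n}
    (h : P.IsStrictLocalMinWrtX (xs, ys)) (hκ : zeroNorm xs = P.κ) :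
    P.IsStrictLocalMinCC xs := by
  obtain ⟨hZ, r, hr, hmin⟩ := h
  refine ⟨fst_mem_ccFeasible hZ, ?_⟩
  have hsupp : ∀ᶠ x in 𝓝 xs, ∀ i, xs i ≠ 0 → x i ≠ 0 := by
    refine eventually_all.2 fun i => ?_
    by_cases hi : xs i = 0
    · exact Eventually.of_forall fun x h => absurd hi h
    · have : ContinuousAt (fun x : Euc n => x i) xs := (PiLp.continuous_apply 2 _ i).continuousAt
      filter_upwards [this.eventually_ne hi] with x hx _ using hx
  obtain ⟨r', hr', hb⟩ := Metric.nhds_basis_ball.eventually_iff.1 hsupp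
  refine ⟨min r r', lt_min hr hr', fun x hx hxf hne => ?_⟩
  have hx1 : dist x xs < r := (Metric.mem_ball.1 hx).trans_le (min_le_left _ _)
  have hx2 := hb (Metric.ball_subset_ball (min_le_right r r') hx)
  -- Nearby points keep the nonzero entries of `xs`; having at most κ of them, they have the same
  -- support, so the same `ys` remains feasible.
  have heq : (Finset.univ.filter fun i => xs i ≠ 0) = Finset.univ.filter fun i => x i ≠ 0 :=
    Finset.eq_of_subset_of_card_le
      (fun i hi => by simpa using hx2 i (Finset.mem_filter.1 hi).2)
      (hxf.2.2.trans hκ.ge)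
  have hsame : ∀ i, x i ≠ 0 → xs i ≠ 0 := fun i hi => by
    have : i ∈ Finset.univ.filter fun i => xs i ≠ 0 := heq ▸ by simpa using hi
    simpa using this
  have hxZ : (x, ys) ∈ P.Z := by
    refine ⟨hxf.1, hxf.2.1, hZ.2.2.1, hZ.2.2.2.1, fun i => ?_⟩
    by_cases hi : x i = 0
    · simp [hi]
    · have h0 : ys i = 0 := (mul_eq_zero.1 (hZ.2.2.2.2 i)).resolve_left (hsame i hi)
      simp [h0]
  refine hmin (x, ys) ?_ hxZ hne
  rw [Metric.mem_ball, Prod.dist_eq, dist_self, max_eq_left dist_nonneg]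
  exact hx1

end CCProblem

/-! ### Second-order analysis; parts (c) and (d) -/

/-- Differentiability of the derivative at x bounds its increment by K‖y - x‖ on the closed ball of
radius ‖y - x‖; the mean value inequality contributes the second factor. -/
theorem exists_quadratic_remainder {n : ℕ} {φ : Euc n → ℝ} (hφ : ContDiff ℝ 2 φ) (x : Euc n) :
    ∃ K, 0 ≤ K ∧ ∀ᶠ y in 𝓝 x, |φ y - φ x - fderiv ℝ φ x (y - x)| ≤ K * ‖y - x‖ ^ 2 := by
  have hd : DifferentiableAt ℝ (fderiv ℝ φ) x :=
    (hφ.fderiv_right (m := 1) (by norm_num)).differentiable one_ne_zero x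
  obtain ⟨K, hK, hbd⟩ := hd.isBigO_sub.exists_nonneg
  obtain ⟨r, hr, hb⟩ := Metric.nhds_basis_ball.eventually_iff.1 hbd.bound
  refine ⟨K, hK, ?_⟩
  filter_upwards [Metric.ball_mem_nhds x hr] with y hy
  have hsub : Metric.closedBall x ‖y - x‖ ⊆ Metric.ball x r :=
    Metric.closedBall_subset_ball (by rwa [← dist_eq_norm])
  have := (convex_closedBall x ‖y - x‖).norm_image_sub_le_of_norm_fderiv_le' (f := φ)
    (φ := fderiv ℝ φ x) (C := K * ‖y - x‖) (x := x) (y := y)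
    (fun u _ => hφ.differentiable two_ne_zero u)
    (fun u hu => (hb (hsub hu)).trans (by
      have : ‖u - x‖ ≤ ‖y - x‖ := by simpa [dist_eq_norm] using hu
      gcongr))
    (Metric.mem_closedBall_self (norm_nonneg _)) (by simp [dist_eq_norm])
  rw [Real.norm_eq_abs] at this
  rwa [sq, ← mul_assoc]

section Directional

variable {n : ℕ} {x : ℕ → Euc n} {xs d : Euc n}

theorem tendsto_difference_quotient (hx : Tendsto x atTop (𝓝 xs))
    (hd : Tendsto (fun k => ‖x k - xs‖⁻¹ • (x k - xs)) atTop (𝓝 d)) {F : Type*}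
    [NormedAddCommGroup F] [NormedSpace ℝ F] {φ : Euc n → F} (hφ : DifferentiableAt ℝ φ xs) :
    Tendsto (fun k => ‖x k - xs‖⁻¹ • (φ (x k) - φ xs)) atTop (𝓝 (fderiv ℝ φ xs d)) := by
  have := (hφ.hasFDerivAt.hasFDerivWithinAt (s := Set.univ)).lim
    (tendsto_sub_nhds_zero_iff.2 hx)
    (Eventually.of_forall fun k => Set.mem_univ (xs + (x k - xs))) hd
  simpa using this

theorem tendsto_hessForm (hx : Tendsto x atTop (𝓝 xs))
    (hd : Tendsto (fun k => ‖x k - xs‖⁻¹ • (x k - xs)) atTop (𝓝 d)) {φ : Euc n → ℝ}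
    (hφ : ContDiff ℝ 2 φ) :
    Tendsto (fun k => ‖x k - xs‖⁻¹ * (fderiv ℝ φ (x k) (‖x k - xs‖⁻¹ • (x k - xs))
      - fderiv ℝ φ xs (‖x k - xs‖⁻¹ • (x k - xs)))) atTop (𝓝 (hessForm φ xs d)) := by
  have h1 := tendsto_difference_quotient hx hd
    ((hφ.fderiv_right (m := 1) (by norm_num)).differentiable one_ne_zero xs)
  exact (isBoundedBilinearMap_apply.continuous.tendsto (fderiv ℝ (fderiv ℝ φ) xs d, d)).comp
    (h1.prodMk_nhds hd)

end Directional

namespace CCProblem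

variable {n m p : ℕ} {P : CCProblem n m p}

theorem Smooth.of_two (hP : P.Smooth 2) : P.Smooth 1 :=
  ⟨hP.1.of_le (by norm_num), fun i => (hP.2.1 i).of_le (by norm_num),
    fun j => (hP.2.2 j).of_le (by norm_num)⟩

/-- The key to the isolation of S-stationary points: a sequence of stationary points
approaching `xs` from the direction `d` with converging multipliers forces the Lagrangian to have
nonpositive curvature along the critical direction `d`. -/
theorem exists_critical_direction (hP : P.Smooth 2) {xs yb d : Euc n} {x y : ℕ → Euc n}
    (hx : Tendsto x atTop (𝓝 xs)) (hne : ∀ k, x k ≠ xs) (hy : Tendsto y atTop (𝓝 yb))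
    (hd : Tendsto (fun k => ‖x k - xs‖⁻¹ • (x k - xs)) atTop (𝓝 d))
    (hZ : ∀ k, (x k, y k) ∈ P.Z) {w : ℕ → Mult m p n}
    (hw : ∀ k, P.IsSMultiplier (x k, y k) (w k).1 (w k).2.1 (w k).2.2) {v : Mult m p n}
    (hwv : Tendsto w atTop (𝓝 v)) (hst : P.statVec 1 v xs = 0)
    (hsign : ∀ i, 0 ≤ v.1 i ∧ v.1 i * P.g i xs = 0) (hsupp : ∀ i, xs i ≠ 0 → v.2.2 i = 0) :
    d ∈ P.critConeX xs ∧ d ≠ 0 ∧ P.IsMMultiplierOf xs v.1 v.2.1 v.2.2 ∧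
      P.lagHessForm xs v.1 v.2.1 d ≤ 0 := by
  have hP1 := hP.of_two
  set s : ℕ → ℝ := fun k => ‖x k - xs‖ with hs
  set D : ℕ → Euc n := fun k => (s k)⁻¹ • (x k - xs) with hD
  have hspos : ∀ k, 0 < s k := fun k => norm_pos_iff.2 (sub_ne_zero.2 (hne k))
  have hDi : ∀ k i, D k i = (s k)⁻¹ * (x k i - xs i) := fun k i => by simp [hD]
  have hd1 : ‖d‖ = 1 := by
    refine tendsto_nhds_unique hd.norm (tendsto_const_nhds.congr fun k => ?_)
    rw [norm_smul, norm_inv, norm_norm, inv_mul_cancel₀ (hspos k).ne']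
  have hd0 : d ≠ 0 := by
    rw [← norm_ne_zero_iff, hd1]; exact one_ne_zero
  have hZb : (xs, yb) ∈ P.Z := mem_Z_of_tendsto hP1 (t := fun _ => 0) tendsto_const_nhds
    (fun k => Z_subset_Zreg le_rfl (hZ k)) (hx.prodMk_nhds hy)
  have hwstat : ∀ k, P.statVec 1 (w k) (x k) = 0 := fun k => by
    simpa [statVec] using (hw k).1.1
  have hη : ∀ k i, x k i ≠ 0 → (w k).2.2 i = 0 := fun k i hi =>
    (hw k).1.2.2 i (Finset.mem_filter.2 ⟨Finset.mem_univ _, hi,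
      (mul_eq_zero.1 ((hZ k).2.2.2.2 i)).resolve_left hi⟩)
  have hw1 : ∀ i, Tendsto (fun k => (w k).1 i) atTop (𝓝 (v.1 i)) := fun i =>
    (((continuous_apply i).comp continuous_fst).tendsto v).comp hwv
  have hw2 : ∀ i, Tendsto (fun k => (w k).2.1 i) atTop (𝓝 (v.2.1 i)) := fun i =>
    (((continuous_apply i).comp (continuous_fst.comp continuous_snd)).tendsto v).comp hwv
  have hw3 : ∀ i, Tendsto (fun k => (w k).2.2 i) atTop (𝓝 (v.2.2 i)) := fun i =>
    (((continuous_apply i).comp (continuous_snd.comp continuous_snd)).tendsto v).comp hwv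
  have hxs0 : ∀ i, ∀ᶠ k in atTop, x k i = 0 → xs i = 0 := fun i => by
    by_cases hi : xs i = 0
    · exact Eventually.of_forall fun _ _ => hi
    · filter_upwards [(tendsto_coord hx i).eventually_ne hi] with k hk h
      exact absurd h hk
  -- A coordinate of x_k is either nonzero, with zero multiplier, or zero like that of `xs`, with
  -- zero increment. So the sparsity terms drop out of the stationarity equations tested on D_k.
  have hηD : ∀ i, ∀ᶠ k in atTop, (w k).2.2 i * D k i = 0 := fun i => by
    filter_upwards [hxs0 i] with k hk
    by_cases hi : x k i = 0
    · rw [hDi, hi, hk hi, sub_zero, mul_zero, mul_zero]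
    · rw [hη k i hi, zero_mul]
  have hvD : ∀ i, ∀ᶠ k in atTop, v.2.2 i * D k i = 0 := fun i => by
    by_cases hv : v.2.2 i = 0
    · exact Eventually.of_forall fun k => by rw [hv, zero_mul]
    · filter_upwards [hxs0 i, (hw3 i).eventually_ne hv] with k hk hk'
      have hi : x k i = 0 := by
        by_contra hi
        exact hk' (hη k i hi)
      rw [hDi, hi, hk hi, sub_zero, mul_zero, mul_zero]
  have hvd : ∀ i, v.2.2 i * d i = 0 := fun i =>
    tendsto_nhds_unique ((tendsto_coord hd i).const_mul _)
      (tendsto_const_nhds.congr' ((hvD i).mono fun k hk => hk.symm))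
  have hquot : ∀ {φ : Euc n → ℝ}, ContDiff ℝ 2 φ →
      Tendsto (fun k => (s k)⁻¹ * (φ (x k) - φ xs)) atTop (𝓝 (fderiv ℝ φ xs d)) := fun hφ =>
    tendsto_difference_quotient hx hd (hφ.differentiable two_ne_zero xs)
  have hgd : ∀ i, P.g i xs = 0 → fderiv ℝ (P.g i) xs d ≤ 0 := fun i hi =>
    le_of_tendsto' (hquot (hP.2.1 i)) fun k => mul_nonpos_of_nonneg_of_nonpos
      (inv_nonneg.2 (hspos k).le) (by rw [hi, sub_zero]; exact (hZ k).1 i)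
  have hhd : ∀ j, fderiv ℝ (P.h j) xs d = 0 := fun j =>
    tendsto_nhds_unique (hquot (hP.2.2 j)) (tendsto_const_nhds.congr fun k => by
      have e1 : P.h j (x k) = 0 := (hZ k).2.1 j
      have e2 : P.h j xs = 0 := hZb.2.1 j
      rw [e1, e2, sub_zero, mul_zero])
  have hvgd : ∀ i, v.1 i * fderiv ℝ (P.g i) xs d = 0 := fun i => by
    by_cases hv : v.1 i = 0
    · rw [hv, zero_mul]
    · have hgx : P.g i xs = 0 := (mul_eq_zero.1 (hsign i).2).resolve_left hv
      have : fderiv ℝ (P.g i) xs d = 0 :=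
        tendsto_nhds_unique (hquot (hP.2.1 i)) (tendsto_const_nhds.congr' (by
          filter_upwards [(hw1 i).eventually_ne hv] with k hk
          have e : P.g i (x k) = 0 := (mul_eq_zero.1 ((hw k).1.2.1 i).2).resolve_left hk
          rw [e, hgx, sub_zero, mul_zero]))
      rw [this, mul_zero]
  have hfd : fderiv ℝ P.f xs d = 0 := by
    have h1 := inner_statVec (P := P) 1 v xs d
    rw [hst, inner_zero_left] at h1
    simp only [hvgd, hhd, hvd, mul_zero, Finset.sum_const_zero, add_zero, one_mul] at h1
    exact h1.symm
  have hdpos : ∀ i, 0 < yb i → d i = 0 := fun i hi => by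
    refine tendsto_nhds_unique (tendsto_coord hd i) (tendsto_const_nhds.congr' ?_)
    filter_upwards [hxs0 i, (tendsto_coord hy i).eventually (lt_mem_nhds hi)] with k hk hk'
    have h0 : x k i = 0 := (mul_eq_zero.1 ((hZ k).2.2.2.2 i)).resolve_right hk'.ne'
    change 0 = D k i
    rw [hDi, h0, hk h0, sub_zero, mul_zero]
  refine ⟨⟨⟨yb, 0, hZb, fun i hi => ?_, fun j => ?_, by simp, by simp, by simp, by simp,
    fun i hi => ?_, by simp⟩, ?_⟩, hd0, ⟨yb, hZb, by simpa [statVec] using hst, hsign,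
    fun i hi => hsupp i (Finset.mem_filter.1 hi).2.1⟩, ?_⟩
  · rw [inner_gradient_eq]
    exact hgd i (Finset.mem_filter.1 hi).2
  · rw [inner_gradient_eq]
    exact hhd j
  · refine hdpos i ?_
    rcases Finset.mem_union.1 hi with hi | hi
    · have h1 : yb i = 1 := (Finset.mem_filter.1 hi).2.2
      rw [h1]; exact one_pos
    · exact (Finset.mem_filter.1 hi).2.2.1
  · rw [inner_gradient_eq, hfd]
  · choose Kg hKg0 hKg using fun i => exists_quadratic_remainder (hP.2.1 i) xs
    choose Kh hKh0 hKh using fun j => exists_quadratic_remainder (hP.2.2 j) xs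
    have hDφ : ∀ (φ : Euc n → ℝ) (k : ℕ), (s k)⁻¹ * fderiv ℝ φ xs (D k)
        = fderiv ℝ φ xs (x k - xs) / s k ^ 2 := fun φ k => by
      simp only [hD, map_smul, smul_eq_mul]
      field_simp
    -- Up to a quadratic remainder the linear term is g_i(x_k), and (w_k - v)_i g_i(x_k) = -v_i
    -- g_i(x_k) ≥ 0 by complementarity, sign and feasibility. Dividing by s_k² leaves a bound with
    -- factor |w_k - v|, which tends to 0.
    have hgb : ∀ i, ∀ᶠ k in atTop,
        -(|(w k).1 i - v.1 i| * Kg i) ≤ ((w k).1 i - v.1 i) * ((s k)⁻¹ * fderiv ℝ (P.g i) xs (D k)) := by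
      intro i
      by_cases hgx : P.g i xs = 0
      · filter_upwards [hx.eventually (hKg i)] with k hk
        rw [hDφ, ← mul_div_assoc, le_div_iff₀ (pow_pos (hspos k) 2)]
        set R := P.g i (x k) - P.g i xs - fderiv ℝ (P.g i) xs (x k - xs) with hR
        have e : fderiv ℝ (P.g i) xs (x k - xs) = P.g i (x k) - R := by rw [hR, hgx]; ring
        have h1 : (w k).1 i * P.g i (x k) = 0 := ((hw k).1.2.1 i).2
        have h2 : v.1 i * P.g i (x k) ≤ 0 :=
          mul_nonpos_of_nonneg_of_nonpos (hsign i).1 ((hZ k).1 i)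
        have h3 : ((w k).1 i - v.1 i) * R ≤ |(w k).1 i - v.1 i| * (Kg i * s k ^ 2) :=
          (le_abs_self _).trans (by
            rw [abs_mul]; exact mul_le_mul_of_nonneg_left hk (abs_nonneg _))
        rw [e]
        linarith
      · have hv : v.1 i = 0 := (mul_eq_zero.1 (hsign i).2).resolve_right hgx
        filter_upwards [(((hP.2.1 i).continuous.tendsto xs).comp hx).eventually_ne hgx] with k hk
        have hwk : (w k).1 i = 0 := (mul_eq_zero.1 ((hw k).1.2.1 i).2).resolve_right hk
        simp [hv, hwk]
    have hhb : ∀ j, ∀ᶠ k in atTop, -(|(w k).2.1 j - v.2.1 j| * Kh j)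
        ≤ ((w k).2.1 j - v.2.1 j) * ((s k)⁻¹ * fderiv ℝ (P.h j) xs (D k)) := by
      intro j
      filter_upwards [hx.eventually (hKh j)] with k hk
      rw [hDφ, ← mul_div_assoc, le_div_iff₀ (pow_pos (hspos k) 2)]
      have e1 : P.h j (x k) = 0 := (hZ k).2.1 j
      have e2 : P.h j xs = 0 := hZb.2.1 j
      rw [e1, e2, sub_zero, zero_sub, abs_neg] at hk
      have h3 := (neg_abs_le (((w k).2.1 j - v.2.1 j) * fderiv ℝ (P.h j) xs (x k - xs)))
      rw [abs_mul] at h3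
      have h4 : |(w k).2.1 j - v.2.1 j| * |fderiv ℝ (P.h j) xs (x k - xs)|
          ≤ |(w k).2.1 j - v.2.1 j| * (Kh j * s k ^ 2) :=
        mul_le_mul_of_nonneg_left hk (abs_nonneg _)
      linarith
    have hlim1 := ((tendsto_hessForm hx hd hP.1).add
      (tendsto_finsetSum Finset.univ fun i _ =>
        (hw1 i).mul (tendsto_hessForm hx hd (hP.2.1 i)))).add
      (tendsto_finsetSum Finset.univ fun j _ =>
        (hw2 j).mul (tendsto_hessForm hx hd (hP.2.2 j)))
    have hlim2 : Tendsto (fun k => ∑ i, |(w k).1 i - v.1 i| * Kg i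
        + ∑ j, |(w k).2.1 j - v.2.1 j| * Kh j) atTop (𝓝 0) := by
      have h1 := (tendsto_finsetSum Finset.univ fun i (_ : i ∈ Finset.univ) =>
        (((hw1 i).sub_const (v.1 i)).abs.mul_const (Kg i))).add
        (tendsto_finsetSum Finset.univ fun j (_ : j ∈ Finset.univ) =>
        (((hw2 j).sub_const (v.2.1 j)).abs.mul_const (Kh j)))
      simpa using h1
    refine le_of_tendsto_of_tendsto hlim1 hlim2 ?_
    filter_upwards [eventually_all.2 hgb, eventually_all.2 hhb, eventually_all.2 hηD,
      eventually_all.2 hvD] with k h1 h2 h3 h4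
    have e1 := inner_statVec (P := P) 1 (w k) (x k) (D k)
    have e2 := inner_statVec (P := P) 1 v xs (D k)
    rw [hwstat, inner_zero_left] at e1
    rw [hst, inner_zero_left] at e2
    simp only [h3, h4, Finset.sum_const_zero, add_zero, one_mul] at e1 e2
    have s1 := Finset.sum_le_sum fun i (_ : i ∈ Finset.univ) => h1 i
    have s2 := Finset.sum_le_sum fun j (_ : j ∈ Finset.univ) => h2 j
    rw [Finset.sum_neg_distrib] at s1 s2
    -- The difference of the two stationarity equations, divided by s_k: gradient increments
    -- weighted by w_k tend to the Hessian form at v, and the rest carries the factor w_k - v.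
    have key : ((s k)⁻¹ * (fderiv ℝ P.f (x k) (D k) - fderiv ℝ P.f xs (D k))
        + ∑ i, (w k).1 i * ((s k)⁻¹ * (fderiv ℝ (P.g i) (x k) (D k) - fderiv ℝ (P.g i) xs (D k)))
        + ∑ j, (w k).2.1 j * ((s k)⁻¹ * (fderiv ℝ (P.h j) (x k) (D k)
          - fderiv ℝ (P.h j) xs (D k))))
        + (∑ i, ((w k).1 i - v.1 i) * ((s k)⁻¹ * fderiv ℝ (P.g i) xs (D k))
        + ∑ j, ((w k).2.1 j - v.2.1 j) * ((s k)⁻¹ * fderiv ℝ (P.h j) xs (D k))) = 0 := by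
      have e3 := congrArg₂ (fun a b => (s k)⁻¹ * (a - b)) e1 e2
      simp only [sub_zero, mul_zero] at e3
      rw [e3]
      simp only [mul_sub, sub_mul, mul_add, Finset.sum_sub_distrib, Finset.mul_sum]
      simp only [mul_left_comm (s k)⁻¹]
      ring
    change _ + _ + _ ≤ _
    linarith

/-- Under CC-MFCQ and the second-order condition, S-stationary points near `xs` lie over `xs`. -/
theorem eventually_not_isSStationary (hP : P.Smooth 2) {xs : Euc n} (hreg : P.NoAbnormalMult xs)
    (hsoc : ∀ dx ∈ P.critConeX xs, dx ≠ 0 →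
      ∀ lam mu gam, P.IsMMultiplierOf xs lam mu gam → 0 < P.lagHessForm xs lam mu dx) :
    ∀ᶠ x in 𝓝 xs, x ≠ xs → ∀ y, ¬ P.IsSStationary (x, y) := by
  have hP1 := hP.of_two
  by_contra hcon
  obtain ⟨x, hx, hnot⟩ := exists_seq_forall_of_frequently (not_eventually.1 hcon)
  push Not at hnot
  choose hne y hZ lam mu gam hmul using hnot
  obtain ⟨⟨d, yb⟩, -, ψ, hψ, hlim⟩ := ((isCompact_sphere (0 : Euc n) 1).prod
    (isCompact_unitBox (n := n))).tendsto_subseq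
    (x := fun k => (‖x k - xs‖⁻¹ • (x k - xs), y k)) fun k => by
      refine ⟨?_, (hZ k).2.2.1⟩
      simp [norm_smul, sub_ne_zero.2 (hne k)]
  have hη : ∀ k i, x k i ≠ 0 → gam k i = 0 := fun k i hi =>
    (hmul k).1.2.2 i (Finset.mem_filter.2 ⟨Finset.mem_univ _, hi,
      (mul_eq_zero.1 ((hZ k).2.2.2.2 i)).resolve_left hi⟩)
  have hxψ := hx.comp hψ.tendsto_atTop
  have hdom : ∀ j, xs j ≠ 0 → ∀ ε > 0, ∀ᶠ k in atTop,
      |gam (ψ k) j| ≤ ε * ‖((lam (ψ k), mu (ψ k), gam (ψ k)) : Mult m p n)‖ := by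
    intro j hj ε hε
    filter_upwards [(tendsto_coord hxψ j).eventually_ne hj] with k hk
    rw [hη _ j hk, abs_zero]
    positivity
  obtain ⟨v, χ, hχ, hwv, hst, hsign, h0⟩ := hreg.exists_subseq_tendsto hP1 hxψ
    (w := fun k => (lam (ψ k), mu (ψ k), gam (ψ k))) (fun k i => (hmul (ψ k)).1.2.1 i) hdom
    (fun k => by simpa [statVec] using (hmul (ψ k)).1.1)
  have hlimχ := hlim.comp hχ.tendsto_atTop
  have hlimd : Tendsto (fun k => ‖x (ψ (χ k)) - xs‖⁻¹ • (x (ψ (χ k)) - xs)) atTop (𝓝 d) :=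
    (continuous_fst.tendsto (d, yb)).comp hlimχ
  have hlimy : Tendsto (fun k => y (ψ (χ k))) atTop (𝓝 yb) :=
    (continuous_snd.tendsto (d, yb)).comp hlimχ
  have hlimw : Tendsto (fun k => ((lam (ψ (χ k)), mu (ψ (χ k)), gam (ψ (χ k))) : Mult m p n))
    atTop (𝓝 v) := hwv
  obtain ⟨hdc, hd0, hM, hle⟩ := exists_critical_direction hP (x := fun k => x (ψ (χ k)))
    (y := fun k => y (ψ (χ k))) (w := fun k => (lam (ψ (χ k)), mu (ψ (χ k)), gam (ψ (χ k))))
    (hxψ.comp hχ.tendsto_atTop) (fun k => hne (ψ (χ k))) hlimy hlimd (fun k => hZ (ψ (χ k)))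
    (fun k => hmul (ψ (χ k))) hlimw hst hsign fun i hi => h0 i (hdom i hi)
  exact absurd (hsoc d hdc hd0 _ _ _ hM) (not_lt.2 hle)

/-- In a small closed ball every limit of KKT points is S-stationary, and every S-stationary point
lies over `xs`; compactness then forces convergence of the x-parts. -/
theorem exists_radius_tendsto (hP : P.Smooth 2) {xs : Euc n} (hreg : P.NoAbnormalMult xs)
    (hsoc : ∀ dx ∈ P.critConeX xs, dx ≠ 0 →
      ∀ lam mu gam, P.IsMMultiplierOf xs lam mu gam → 0 < P.lagHessForm xs lam mu dx) :
    ∃ r > 0, ∀ t : ℕ → ℝ, (∀ k, 0 < t k) → Tendsto t atTop (𝓝 0) →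
      ∀ z : ℕ → Euc n × Euc n,
        (∀ᶠ k in atTop, P.IsKKTReg (t k) (z k) ∧ (z k).1 ∈ Metric.ball xs r) →
          Tendsto (fun k => (z k).1) atTop (𝓝 xs) := by
  have hP1 := hP.of_two
  obtain ⟨r, hr, hball⟩ := Metric.nhds_basis_closedBall.eventually_iff.1
    ((hreg.eventually hP1).and (eventually_not_isSStationary hP hreg hsoc))
  refine ⟨r, hr, fun t ht ht0 z hz => ?_⟩
  by_contra hcon
  obtain ⟨U, hU, hfr⟩ := not_tendsto_iff_exists_frequently_notMem.1 hcon
  obtain ⟨zb, ψ, hzb, hψ, hK, hlim⟩ := exists_subseq_of_mem_closedBall (hfr.and_eventually hz)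
    (fun k hk => Metric.ball_subset_closedBall hk.2.2) (fun k hk => hk.2.1.1.2.2.1)
  have hS := isSStationary_of_tendsto hP1 (fun k => ht (ψ k)) (ht0.comp hψ.tendsto_atTop)
    (fun k => (hK k).2.1) hlim (hball hzb).1
  have hx : zb.1 = xs := by
    by_contra hne
    exact (hball hzb).2 hne zb.2 hS
  have hlim1 : Tendsto (fun k => (z (ψ k)).1) atTop (𝓝 xs) :=
    hx ▸ (continuous_fst.tendsto zb).comp hlim
  obtain ⟨k, hk⟩ := (hlim1.eventually hU).exists
  exact (hK k).1 hk

/-- If `‖xs‖₀ = κ`, convergence of the `x`-components of feasible points of `NLP(t_k)` implies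
convergence of the points. -/
theorem tendsto_of_tendsto_fst (hP : P.Smooth 1) {t : ℕ → ℝ} (ht0 : Tendsto t atTop (𝓝 0))
    {z : ℕ → Euc n × Euc n} (hz : ∀ᶠ k in atTop, z k ∈ P.Zreg (t k)) {xs ys : Euc n}
    (hZ : (xs, ys) ∈ P.Z) (hκ : zeroNorm xs = P.κ)
    (hx : Tendsto (fun k => (z k).1) atTop (𝓝 xs)) : Tendsto z atTop (𝓝 (xs, ys)) := by
  by_contra hcon
  obtain ⟨U, hU, hfr⟩ := not_tendsto_iff_exists_frequently_notMem.1 hcon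
  obtain ⟨zb, ψ, -, hψ, hK, hlim⟩ := exists_subseq_of_mem_closedBall
    (hfr.and_eventually (hz.and (hx.eventually (Metric.closedBall_mem_nhds xs one_pos))))
    (fun k hk => hk.2.2) (fun k hk => hk.2.1.2.2.1)
  have hzb := mem_Z_of_tendsto hP (ht0.comp hψ.tendsto_atTop) (fun k => (hK k).2.1) hlim
  have h1 : zb.1 = xs := tendsto_nhds_unique ((continuous_fst.tendsto zb).comp hlim)
    (hx.comp hψ.tendsto_atTop)
  obtain ⟨xb, yb⟩ := zb
  obtain rfl : xb = xs := h1
  have h2 : yb = ys := by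
    ext i
    rw [snd_eq_of_mem_Z hzb hκ i, snd_eq_of_mem_Z hZ hκ i]
  obtain ⟨k, hk⟩ := ((h2 ▸ hlim).eventually hU).exists
  exact (hK k).1 hk

/-- If `‖xs‖₀ = κ`, the second-order condition for S-stationary multipliers of `(xs, ys)` implies the
one for M-stationary multipliers of `xs`. -/
theorem second_order_condition_of_zeroNorm_eq {xs ys : Euc n} (hZ : (xs, ys) ∈ P.Z)
    (hκ : zeroNorm xs = P.κ)
    (hsoc : ∀ d ∈ P.critCone (xs, ys), d.1 ≠ 0 →
      ∀ lam mu gam, P.IsSMultiplier (xs, ys) lam mu gam → 0 < P.lagHessForm xs lam mu d.1) :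
    ∀ dx ∈ P.critConeX xs, dx ≠ 0 →
      ∀ lam mu gam, P.IsMMultiplierOf xs lam mu gam → 0 < P.lagHessForm xs lam mu dx := by
  have huniq : ∀ y, (xs, y) ∈ P.Z → y = ys := fun y hy => by
    ext i
    rw [snd_eq_of_mem_Z hy hκ i, snd_eq_of_mem_Z hZ hκ i]
  rintro dx ⟨⟨y, dy, hy, hlin⟩, hf⟩ hne lam mu gam ⟨y', hy', hM⟩
  obtain rfl := huniq y hy
  obtain rfl := huniq y' hy'
  -- I_{00} is empty: x_i = 0 forces y_i = 1, so M- and S-multipliers coincide.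
  refine hsoc (dx, dy) ⟨hlin, hf⟩ hne lam mu gam ⟨hM, fun i hi => ?_⟩
  obtain ⟨h0, h1⟩ := (Finset.mem_filter.1 hi).2
  have h2 := snd_eq_of_mem_Z hZ hκ i
  simp only at h0 h1
  rw [h1] at h2
  simp [h0] at h2

theorem IsStrictLocalMinCC.eventually_exists_isKKTReg (hP : P.Smooth 1) {xs : Euc n}
    (hxs : P.IsStrictLocalMinCC xs) (hreg : P.CCMFCQ xs) {r : ℝ} (hr : 0 < r) {t : ℕ → ℝ}
    (ht : ∀ k, 0 < t k) (ht0 : Tendsto t atTop (𝓝 0)) :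
    ∀ᶠ k in atTop, ∃ z : Euc n × Euc n, P.IsKKTReg (t k) z ∧ z.1 ∈ Metric.ball xs r := by
  obtain ⟨T, hT, h⟩ := hxs.exists_isKKTReg hP hreg hr
  filter_upwards [ht0.eventually (gt_mem_nhds hT)] with k hk
  obtain ⟨z, -, hz⟩ := h (t k) (ht k) hk.le
  exact ⟨z, hz⟩

end CCProblem

end

theorem mainTheorem4 {n m p : ℕ} (P : CCProblem n m p) (hκ : P.κ < n) (hC1 : P.Smooth 1) :
    -- part (a), for strict local minimizers of the cardinality constrained problem
    (∀ xs : Euc n, P.IsStrictLocalMinCC xs → P.CCMFCQ xs →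
      ∃ T > 0, ∃ r > 0, ∀ t : ℝ, 0 < t → t ≤ T →
        ∃ z : Euc n × Euc n, P.IsLocalMinReg t z ∧ P.IsKKTReg t z ∧ z.1 ∈ Metric.ball xs r) ∧
    -- part (a), for strict local minima with respect to x of the reformulation
    (∀ xs ys : Euc n, P.IsStrictLocalMinWrtX (xs, ys) → zeroNorm xs = P.κ → P.CCMFCQ xs →
      ∃ T > 0, ∃ r > 0, ∀ t : ℝ, 0 < t → t ≤ T →
        ∃ z : Euc n × Euc n, P.IsLocalMinReg t z ∧ P.IsKKTReg t z ∧ z.1 ∈ Metric.ball xs r) ∧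
    -- part (b)
    (∀ xs ys : Euc n, (xs, ys) ∈ P.Z → P.CCMFCQ xs →
      ∃ r₀ > 0, ∀ r : ℝ, 0 < r → r ≤ r₀ →
        ∀ t : ℕ → ℝ, (∀ k, 0 < t k) → Tendsto t atTop (𝓝 0) →
          ∀ z : ℕ → Euc n × Euc n,
            (∀ k, P.IsKKTReg (t k) (z k) ∧ (z k).1 ∈ Metric.ball xs r) →
              (∃ zbar, MapClusterPt zbar atTop z) ∧
              ∀ zbar, MapClusterPt zbar atTop z → P.IsSStationary zbar) ∧
    -- part (c)
    (P.Smooth 2 →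
      ∀ xs ys : Euc n, P.IsStrictLocalMinWrtX (xs, ys) → zeroNorm xs = P.κ → P.CCMFCQ xs →
        (∀ d ∈ P.critCone (xs, ys), d.1 ≠ 0 →
          ∀ lam mu gam, P.IsSMultiplier (xs, ys) lam mu gam → 0 < P.lagHessForm xs lam mu d.1) →
        ∃ r > 0, ∀ t : ℕ → ℝ, (∀ k, 0 < t k) → Tendsto t atTop (𝓝 0) →
          (∀ᶠ k in atTop, ∃ z : Euc n × Euc n,
            P.IsKKTReg (t k) z ∧ z.1 ∈ Metric.ball xs r) ∧
          ∀ z : ℕ → Euc n × Euc n,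
            (∀ᶠ k in atTop, P.IsKKTReg (t k) (z k) ∧ (z k).1 ∈ Metric.ball xs r) →
              Tendsto z atTop (𝓝 (xs, ys))) ∧
    -- part (d)
    (P.Smooth 2 →
      ∀ xs : Euc n, P.IsStrictLocalMinCC xs → P.CCMFCQ xs →
        (∀ dx ∈ P.critConeX xs, dx ≠ 0 →
          ∀ lam mu gam, P.IsMMultiplierOf xs lam mu gam → 0 < P.lagHessForm xs lam mu dx) →
        ∃ r > 0, ∀ t : ℕ → ℝ, (∀ k, 0 < t k) → Tendsto t atTop (𝓝 0) →
          (∀ᶠ k in atTop, ∃ z : Euc n × Euc n,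
            P.IsKKTReg (t k) z ∧ z.1 ∈ Metric.ball xs r) ∧
          ∀ z : ℕ → Euc n × Euc n,
            (∀ᶠ k in atTop, P.IsKKTReg (t k) (z k) ∧ (z k).1 ∈ Metric.ball xs r) →
              Tendsto (fun k => (z k).1) atTop (𝓝 xs)) := by
  refine ⟨fun xs hxs hreg => ?_, fun xs ys hmin hκ' hreg => ?_, fun xs ys _ hreg => ?_,
    fun hC2 xs ys hmin hκ' hreg hsoc => ?_, fun hC2 xs hxs hreg hsoc => ?_⟩
  · obtain ⟨T, hT, h⟩ := hxs.exists_isKKTReg hC1 hreg one_pos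
    exact ⟨T, hT, 1, one_pos, h⟩
  · obtain ⟨T, hT, h⟩ := (hmin.isStrictLocalMinCC hκ').exists_isKKTReg hC1 hreg one_pos
    exact ⟨T, hT, 1, one_pos, h⟩
  · obtain ⟨r₀, hr₀, h⟩ := CCProblem.convergence_of_kkt hC1 hreg
    exact ⟨r₀, hr₀, fun r _ hr => h r hr⟩
  · obtain ⟨r, hr, h⟩ := CCProblem.exists_radius_tendsto hC2 hreg.noAbnormalMult
      (CCProblem.second_order_condition_of_zeroNorm_eq hmin.1 hκ' hsoc)
    exact ⟨r, hr, fun t ht ht0 =>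
      ⟨(hmin.isStrictLocalMinCC hκ').eventually_exists_isKKTReg hC1 hreg hr ht ht0, fun z hz =>
        CCProblem.tendsto_of_tendsto_fst hC1 ht0 (hz.mono fun k hk => hk.1.1) hmin.1 hκ'
          (h t ht ht0 z hz)⟩⟩
  · obtain ⟨r, hr, h⟩ := CCProblem.exists_radius_tendsto hC2 hreg.noAbnormalMult hsoc
    exact ⟨r, hr, fun t ht ht0 =>
      ⟨hxs.eventually_exists_isKKTReg hC1 hreg hr ht ht0, h t ht ht0⟩⟩
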